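/- Let $H$ be the Hilbert transform $H(f)(x)=\frac1\pi\,\mathrm{p.v.}\int_{\mathbb R}\frac{f(y)}{y-x}\,dy$ (principal value at $y=x$ and at infinity) and consider, for $\sigma\in\{+1,-1\}$, the nonlocal derivative NLS equation $$ i u_t=u_{xx}+\sigma u\,(i+H)(|u|^2)_x,\qquad u:\mathbb R\times\mathbb R\to\mathbb C. \tag{1}$$ Let $k_1>0$ and $c_1\in\mathbb R$ be such that: if $\sigma=1$, then $k_1\in(0,1)$ and $c_1\in(-2+k_1,-k_1)$; if $\sigma=-1$, then $c_1\in(k_1+2,\infty)$ or $c_1\in(-\infty,-k_1)$. Then there are unique $\phi_1>0$, $\psi_1\in\mathbb R$ with $$ e^{2\phi_1}=\frac{(c_1-k_1)(c_1+k_1+2\sigma)}{(c_1+k_1)(c_1-k_1+2\sigma)},\qquad e^{\psi_1}=\frac{c_1+k_1}{c_1-k_1}\,e^{\phi_1}. $$ For $x_1,x_2,c_2\in\mathbb R$ put $\xi_j=x-c_jt-x_j$, let $$ u_{\rm per}(x,t)=e^{\frac12(\psi_1-\phi_1)}\,\frac{1+e^{ik_1\xi_1-\psi_1}}{1+e^{ik_1\xi_1-\phi_1}}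 $$ be the traveling periodic wave, and put $$ \gamma_1=\sqrt{\tfrac{c_1+k_1}{c_1-k_1}},\qquad \alpha_2=-\tfrac12\sigma c_2(c_2+2\sigma),\qquad \beta_{12}=\frac{2k_1}{(c_1-c_2)^2-k_1^2}, $$ $$\begin{aligned} f&=(1-i\alpha_2\xi_2)(1+e^{ik_1\xi_1-\phi_1})+\alpha_2\beta_{12}(1-e^{ik_1\xi_1-\phi_1}),\\ \tilde f&=-(1+i\alpha_2\xi_2)(1+e^{ik_1\xi_1+\phi_1})+\alpha_2\beta_{12}(1-e^{ik_1\xi_1+\phi_1}),\\ g&=-\gamma_1(1+\sigma c_2+i\alpha_2\xi_2)(1+e^{ik_1\xi_1-\psi_1})+\gamma_1\alpha_2\beta_{12}(1-e^{ik_1\xi_1-\psi_1}),\\ \tilde g&=\gamma_1^{-1}(1+\sigma c_2-i\alpha_2\xi_2)(1+e^{ik_1\xi_1+\psi_1})+\gamma_1^{-1}\alpha_2\beta_{12}(1-e^{ik_1\xi_1+\psi_1}). \end{aligned}$$ Then $\frac{c_1+k_1}{c_1-k_1}>0$ and $\gamma_1>0$, and the conditions $\alpha_2>0$ and $\beta_{12}>0$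 (with $(c_1-c_2)^2\ne k_1^2$) hold simultaneously if and only if $c_2$ belongs to one of the following intervals: - if $\sigma=+1$ (and $c_1\in(-2+k_1,-k_1)$): $c_2\in(-2,c_1-k_1)$ or $c_2\in(c_1+k_1,0)$; - if $\sigma=-1$ and $c_1\in(k_1+2,\infty)$: $c_2\in(c_1+k_1,\infty)$ or $c_2\in(2,c_1-k_1)$ or $c_2\in(-\infty,0)$; - if $\sigma=-1$ and $c_1\in(-\infty,-k_1)$: $c_2\in(c_1+k_1,0)$ or $c_2\in(-\infty,c_1-k_1)$ or $c_2\in(2,\infty)$. For every such $c_2$ and all $x_1,x_2\in\mathbb R$ the following hold. 1. For every $t\in\mathbb R$, all zeros $x\in\mathbb C$ of $f$ satisfy $\operatorname{Im}x<0$ and all zeros $x\in\mathbb C$ of $\tilde f$ satisfy $\operatorname{Im}x>0$. 2. The function $u=g/f$ on $\mathbb R\times\mathbb R$ satisfies $$ \bar u=\frac{\tilde g}{\tilde f},\qquad |u|^2=1-i\sigma\,\frac{\partial}{\partial x}\ln\frac{f}{\tilde f}, $$ where $\partial_x\ln(f/\tilde f)$ denotes the logarithmic derivative. 3. $u$ is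 $C^2$ on $\mathbb R\times\mathbb R$, the principal value $H(|u|^2)_x$ exists at every point, and $u$ solves (1) everywhere. 4. $u$ is a solitary wave of speed $c_2$ on the traveling periodic wave: $u(x,t)-u_{\rm per}(x,t)\to0$ as $|\xi_2|\to\infty$, uniformly in $(x,t)$, and for every $t$ the functions $u(\cdot,t)$ and $u_{\rm per}(\cdot,t)$ are not identical. -/

import Mathlib

open Filter Topology MeasureTheory

namespace NDNLS

noncomputable section

/-- The Hilbert transform of `f` at `x` exists as a principal value (both at the singularity `y = x`
and at infinity) and equals `h`:
`h = (1/π) lim ∫_{ε < |y - x| < R} f(y) / (y - x) dy` as `ε → 0+`, `R → ∞`. -/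
def HasHilbertTransform (f : ℝ → ℂ) (x : ℝ) (h : ℂ) : Prop :=
  LocallyIntegrable f volume ∧
    Tendsto
      (fun p : ℝ × ℝ =>
        (1 / (Real.pi : ℂ)) *
          ∫ y in {y : ℝ | p.1 < |y - x| ∧ |y - x| < p.2}, f y / ((y : ℂ) - (x : ℂ)))
      ((𝓝[>] (0 : ℝ)) ×ˢ atTop) (𝓝 h)

/-- The derivative `(|u|^2)_x` at `(x, t)`, as a complex number. -/
def densityDeriv (u : ℝ → ℝ → ℂ) (t x : ℝ) : ℂ :=
  ((deriv (fun y : ℝ => ‖u y t‖ ^ 2) x : ℝ) : ℂ)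

/-- Global classical solutions `u = u(x, t)` of
`i u_t = u_xx + σ u (i + H) (|u|^2)_x` on `ℝ × ℝ`. -/
structure IsClassicalSolution (σ : ℝ) (u : ℝ → ℝ → ℂ) : Prop where
  contDiff : ContDiff ℝ 2 (fun p : ℝ × ℝ => u p.1 p.2)
  equation : ∀ x t : ℝ, ∃ h : ℂ, HasHilbertTransform (densityDeriv u t) x h ∧
    Complex.I * deriv (fun s : ℝ => u x s) t =
      iteratedDeriv 2 (fun y : ℝ => u y t) x
        + (σ : ℂ) * u x t * (Complex.I * densityDeriv u t x + h)

/-- Admissible wave numbers `k` and speeds `c` of the traveling periodic wave. -/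
def AdmissibleWave (σ k c : ℝ) : Prop :=
  (σ = 1 ∧ 0 < k ∧ k < 1 ∧ -2 + k < c ∧ c < -k) ∨
  (σ = -1 ∧ 0 < k ∧ (k + 2 < c ∨ c < -k))

/-- The phase parameters `φ > 0` and `ψ` of the traveling periodic wave. -/
def IsPhase (σ k c φ ψ : ℝ) : Prop :=
  0 < φ ∧
  Real.exp (2 * φ) = ((c - k) * (c + k + 2 * σ)) / ((c + k) * (c - k + 2 * σ)) ∧
  Real.exp ψ = (c + k) / (c - k) * Real.exp φ

/-- The listed intervals of speeds `c₂` of the solitary wave. -/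
def AdmissibleSpeed (σ k₁ c₁ c₂ : ℝ) : Prop :=
  (σ = 1 ∧ -2 + k₁ < c₁ ∧ c₁ < -k₁ ∧
    (c₂ ∈ Set.Ioo (-2) (c₁ - k₁) ∨ c₂ ∈ Set.Ioo (c₁ + k₁) 0)) ∨
  (σ = -1 ∧ k₁ + 2 < c₁ ∧
    (c₂ ∈ Set.Ioi (c₁ + k₁) ∨ c₂ ∈ Set.Ioo 2 (c₁ - k₁) ∨ c₂ ∈ Set.Iio 0)) ∨
  (σ = -1 ∧ c₁ < -k₁ ∧
    (c₂ ∈ Set.Ioo (c₁ + k₁) 0 ∨ c₂ ∈ Set.Iio (c₁ - k₁) ∨ c₂ ∈ Set.Ioi 2))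

/-- `ξ = x - c t - x₀`, for complex `x`. -/
def xi (c x₀ : ℝ) (x : ℂ) (t : ℝ) : ℂ := x - (c : ℂ) * (t : ℂ) - (x₀ : ℂ)

/-- `exp (i k ξ + a)` with `ξ = x - c t - x₀`. -/
def wave (k c x₀ a : ℝ) (x : ℂ) (t : ℝ) : ℂ :=
  Complex.exp (Complex.I * (k : ℂ) * xi c x₀ x t + (a : ℂ))

/-- The traveling periodic wave on the nonzero background. -/
def periodicWave (k c x₀ φ ψ : ℝ) (x t : ℝ) : ℂ :=
  (Real.exp ((ψ - φ) / 2) : ℂ) *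
    ((1 + wave k c x₀ (-ψ) x t) / (1 + wave k c x₀ (-φ) x t))

def gam (k c : ℝ) : ℝ := Real.sqrt ((c + k) / (c - k))

def alph (σ c₂ : ℝ) : ℝ := -(1 / 2) * σ * c₂ * (c₂ + 2 * σ)

def bet (k₁ c₁ c₂ : ℝ) : ℝ := 2 * k₁ / ((c₁ - c₂) ^ 2 - k₁ ^ 2)

/-- The function `f`, for complex `x`. -/
def f (σ k₁ c₁ x₁ c₂ x₂ φ : ℝ) (x : ℂ) (t : ℝ) : ℂ :=
  (1 - Complex.I * (alph σ c₂ : ℂ) * xi c₂ x₂ x t) * (1 + wave k₁ c₁ x₁ (-φ) x t)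
    + (alph σ c₂ : ℂ) * (bet k₁ c₁ c₂ : ℂ) * (1 - wave k₁ c₁ x₁ (-φ) x t)

/-- The function `f̃`, for complex `x`. -/
def fTilde (σ k₁ c₁ x₁ c₂ x₂ φ : ℝ) (x : ℂ) (t : ℝ) : ℂ :=
  -(1 + Complex.I * (alph σ c₂ : ℂ) * xi c₂ x₂ x t) * (1 + wave k₁ c₁ x₁ φ x t)
    + (alph σ c₂ : ℂ) * (bet k₁ c₁ c₂ : ℂ) * (1 - wave k₁ c₁ x₁ φ x t)

/-- The function `g`, for complex `x`. -/
def g (σ k₁ c₁ x₁ c₂ x₂ ψ : ℝ) (x : ℂ) (t : ℝ) : ℂ :=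
  -(gam k₁ c₁ : ℂ) * (1 + (σ : ℂ) * (c₂ : ℂ) + Complex.I * (alph σ c₂ : ℂ) * xi c₂ x₂ x t)
      * (1 + wave k₁ c₁ x₁ (-ψ) x t)
    + (gam k₁ c₁ : ℂ) * (alph σ c₂ : ℂ) * (bet k₁ c₁ c₂ : ℂ) * (1 - wave k₁ c₁ x₁ (-ψ) x t)

/-- The function `g̃`, for complex `x`. -/
def gTilde (σ k₁ c₁ x₁ c₂ x₂ ψ : ℝ) (x : ℂ) (t : ℝ) : ℂ :=
  (gam k₁ c₁ : ℂ)⁻¹ * (1 + (σ : ℂ) * (c₂ : ℂ) - Complex.I * (alph σ c₂ : ℂ) * xi c₂ x₂ x t)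
      * (1 + wave k₁ c₁ x₁ ψ x t)
    + (gam k₁ c₁ : ℂ)⁻¹ * (alph σ c₂ : ℂ) * (bet k₁ c₁ c₂ : ℂ) * (1 - wave k₁ c₁ x₁ ψ x t)

/-- The breather `u = g / f`, for real `x` and `t`. -/
def breather (σ k₁ c₁ x₁ c₂ x₂ φ ψ : ℝ) (x t : ℝ) : ℂ :=
  g σ k₁ c₁ x₁ c₂ x₂ ψ x t / f σ k₁ c₁ x₁ c₂ x₂ φ x t

/-- `u` is a solitary wave of speed `c` and initial position `x₀` on the background `w`:
`u - w → 0` as `|x - c t - x₀| → ∞`, uniformly in `(x, t)`, and `u ≠ w` at every time. -/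
def IsSolitaryWaveOn (c x₀ : ℝ) (u w : ℝ → ℝ → ℂ) : Prop :=
  Tendsto (fun p : ℝ × ℝ => u p.1 p.2 - w p.1 p.2)
    (comap (fun p : ℝ × ℝ => |p.1 - c * p.2 - x₀|) atTop) (𝓝 0) ∧
  ∀ t : ℝ, ∃ x : ℝ, u x t ≠ w x t

end

end NDNLS

/-!
The functions `f`, `f̃`, `g`, `g̃` are all of the form
`(p + q ξ₂) (1 + m e^{i k₁ ξ₁}) + r (1 - m e^{i k₁ ξ₁})`, called `profile` below, with real `p`,
`r`, `m` and imaginary `q` up to a common real factor.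

Location of zeros. Write `w = e^{i k₁ ξ₁ - φ}`. In the closed upper half plane `|w| < 1`, so
`f = (1 + w) (1 - i α ξ₂ + α β (1 - w) / (1 + w))`, and the second factor has real part at least
`1 + α Im x`, since the Cayley transform maps the unit disk into the right half plane
(`le_norm_profile`). Up to a nowhere vanishing exponential factor, `f̃` is the reflection
`conj (f (conj x))`, and `g̃` is the reflection of `g` up to the same factor (`fTilde_eq_conj`,
`BreatherData.gTilde_eq_conj`). This settles the zeros of `f̃` and the formula for `conj u`.

Equation. Two bilinear identities hold, `g g̃ = f f̃ - i σ (f_x f̃ - f f̃_x)` and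
`i (g_t f - g f_t) = g_xx f - 2 g_x f_x + g f_xx` (`bilinear_density`, `bilinear_evolution`). The
first is the formula for `|u|²`; together with the reflection symmetry it reads
`|u|² = 1 - σ k₁ + 2 σ Im (∂ₓ ln f)` on the real line. The function `∂ₓ² ln f` is holomorphic and
bounded in the closed upper half plane and tends to zero as `Im x → ∞`: it is a polynomial in `w`,
`1 / (1 + w)` and `1 / f` in which each term contains `w` or `1 / f` (`profileLogXX_eq_logXXPoly`).
By Cauchy's theorem on a half annulus `H (∂ₓ² ln f) = i ∂ₓ² ln f`
(`hasHilbertTransform_of_upperHalfPlane`), hence `(i + H) (|u|²)_x = 2 σ ∂ₓ² ln f`. The equation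
becomes `i u_t = u_xx + 2 u ∂ₓ² ln f`, which is the second bilinear identity.

Asymptotics. In `u - u_per` the terms of `g` and `f` proportional to `ξ₂` cancel in the numerator
(`BreatherData.breather_sub_periodicWave`), while `|f|` grows linearly in `|ξ₂|`. If the difference
vanished identically at some time, then evaluating the numerator at `e^{i k₁ ξ₁} = 1` and
`e^{i k₁ ξ₁} = -1` would give `2 + σ c₂ = 0`, contradicting `α₂ > 0`.
-/

/-! ### The Hilbert transform of boundary values -/

namespace NDNLS

/-- In the coordinates `y = x ± exp s`, the truncated principal value integral becomes a difference
of two integrals of `F (x + exp ·)` over the horizontal sides of the strip `0 ≤ Im s ≤ π`. -/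
theorem setIntegral_truncated_eq {F : ℝ → ℂ} (hF : Continuous F) (x : ℝ) {ε R : ℝ} (hε : 0 < ε)
    (hεR : ε < R) :
    ∫ y in {y : ℝ | ε < |y - x| ∧ |y - x| < R}, F y / ((y : ℂ) - (x : ℂ)) =
      (∫ s in Real.log ε..Real.log R, F (x + Real.exp s)) -
        ∫ s in Real.log ε..Real.log R, F (x - Real.exp s) := by
  have hR : 0 < R := hε.trans hεR
  have hset : {y : ℝ | ε < |y - x| ∧ |y - x| < R} =
      Set.Ioo (x + ε) (x + R) ∪ Set.Ioo (x - R) (x - ε) := by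
    ext y
    simp only [Set.mem_ofPred_eq, Set.mem_union, Set.mem_Ioo]
    rcases le_total 0 (y - x) with h | h
    · rw [abs_of_nonneg h]
      constructor
      · rintro ⟨h1, h2⟩; left; constructor <;> linarith
      · rintro (⟨h1, h2⟩ | ⟨h1, h2⟩) <;> constructor <;> linarith
    · rw [abs_of_nonpos h]
      constructor
      · rintro ⟨h1, h2⟩; right; constructor <;> linarith
      · rintro (⟨h1, h2⟩ | ⟨h1, h2⟩) <;> constructor <;> linarith
  have hcont : ∀ s : Set ℝ, (∀ y ∈ s, y ≠ x) →
      ContinuousOn (fun y : ℝ => F y / ((y : ℂ) - (x : ℂ))) s := by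
    intro s hs
    refine hF.continuousOn.div (by fun_prop) ?_
    intro y hy
    rw [sub_ne_zero]
    exact_mod_cast hs y hy
  have hint : ∀ a b : ℝ, (∀ y ∈ Set.Icc a b, y ≠ x) →
      IntegrableOn (fun y : ℝ => F y / ((y : ℂ) - (x : ℂ))) (Set.Ioo a b) := fun a b h =>
    ((hcont _ h).integrableOn_compact isCompact_Icc).mono_set Set.Ioo_subset_Icc_self
  have hne1 : ∀ y ∈ Set.Icc (x + ε) (x + R), y ≠ x := by
    rintro y ⟨h1, h2⟩ rfl; linarith
  have hne2 : ∀ y ∈ Set.Icc (x - R) (x - ε), y ≠ x := by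
    rintro y ⟨h1, h2⟩ rfl; linarith
  rw [hset, setIntegral_union _ measurableSet_Ioo (hint _ _ hne1) (hint _ _ hne2),
    ← integral_Ioc_eq_integral_Ioo, ← integral_Ioc_eq_integral_Ioo,
    ← intervalIntegral.integral_of_le (by linarith), ← intervalIntegral.integral_of_le (by linarith)]
  · rw [sub_eq_add_neg (∫ s in _.._, F (x + Real.exp s)), ← intervalIntegral.integral_symm]
    have hexp : ∀ s : ℝ, (Real.exp s : ℂ) ≠ 0 := fun s => by exact_mod_cast (Real.exp_pos s).ne'
    congr 1
    · have := intervalIntegral.integral_deriv_smul_comp' (a := Real.log ε) (b := Real.log R)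
        (f := fun s => x + Real.exp s) (f' := Real.exp)
        (g := fun y : ℝ => F y / ((y : ℂ) - (x : ℂ)))
        (fun s _ => (Real.hasDerivAt_exp s).const_add x) Real.continuous_exp.continuousOn
        (hcont _ (by rintro _ ⟨s, -, rfl⟩; have := Real.exp_pos s; simp))
      simp only [Real.exp_log hε, Real.exp_log hR, Function.comp_def] at this
      rw [← this]
      refine intervalIntegral.integral_congr fun s _ => ?_
      have := hexp s
      simp only [Complex.real_smul]
      push_cast at this ⊢
      field_simp
      rw [add_sub_cancel_left, mul_comm]
    · have := intervalIntegral.integral_deriv_smul_comp' (a := Real.log R) (b := Real.log ε)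
        (f := fun s => x - Real.exp s) (f' := fun s => -Real.exp s)
        (g := fun y : ℝ => F y / ((y : ℂ) - (x : ℂ)))
        (fun s _ => (Real.hasDerivAt_exp s).const_sub x) Real.continuous_exp.neg.continuousOn
        (hcont _ (by rintro _ ⟨s, -, rfl⟩; have := Real.exp_pos s; simp))
      simp only [Real.exp_log hε, Real.exp_log hR, Function.comp_def] at this
      rw [← this]
      refine intervalIntegral.integral_congr fun s _ => ?_
      have := hexp s
      simp only [Complex.real_smul]
      push_cast at this ⊢
      rw [sub_sub_cancel_left, mul_div_assoc', mul_comm,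
        mul_div_cancel_right₀ _ (neg_ne_zero.2 this)]
  · rw [Set.disjoint_left]
    rintro y ⟨h1, h2⟩ ⟨h3, h4⟩
    linarith

/-- Cauchy's theorem on the rectangle `[log ε, log R] × [0, π]` for `s ↦ F (x + exp s)`, that is,
on a half annulus in the upper half plane. -/
theorem setIntegral_truncated_eq_arcs {F : ℂ → ℂ} (hd : ∀ z : ℂ, 0 ≤ z.im → DifferentiableAt ℂ F z)
    (x : ℝ) {ε R : ℝ} (hε : 0 < ε) (hεR : ε < R) :
    ∫ y in {y : ℝ | ε < |y - x| ∧ |y - x| < R}, F y / ((y : ℂ) - (x : ℂ)) =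
      Complex.I * (∫ θ in (0 : ℝ)..Real.pi, F (x + ε * Complex.exp (θ * Complex.I))) -
        Complex.I * ∫ θ in (0 : ℝ)..Real.pi, F (x + R * Complex.exp (θ * Complex.I)) := by
  have hR : 0 < R := hε.trans hεR
  have hc : Continuous fun y : ℝ => F y := continuous_iff_continuousAt.2 fun y =>
    (hd y (by simp)).continuousAt.comp Complex.continuous_ofReal.continuousAt
  rw [setIntegral_truncated_eq hc x hε hεR]
  have key := Complex.integral_boundary_rect_eq_zero_of_differentiableOn
    (fun s => F (x + Complex.exp s)) (Real.log ε) (Real.log R + Real.pi * Complex.I) (by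
      intro s hs
      refine DifferentiableAt.differentiableWithinAt ?_
      have him : s.im ∈ Set.Icc 0 Real.pi := by
        have := (Complex.mem_reProdIm.1 hs).2
        simpa [Set.uIcc_of_le Real.pi_pos.le, -Set.mem_Icc] using this
      refine DifferentiableAt.comp s (g := F) (hd _ ?_) (by fun_prop)
      simp only [Complex.add_im, Complex.ofReal_im, zero_add, Complex.exp_im]
      exact mul_nonneg (Real.exp_pos _).le (Real.sin_nonneg_of_nonneg_of_le_pi him.1 him.2))
  have e1 : ∀ s : ℝ, Complex.exp ((s : ℂ) + Real.pi * Complex.I) = -Complex.exp s := fun s => by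
    rw [Complex.exp_add, Complex.exp_pi_mul_I]; ring
  have e2 : ∀ r θ : ℝ, 0 < r → Complex.exp ((Real.log r : ℂ) + θ * Complex.I) =
      r * Complex.exp (θ * Complex.I) := fun r θ hr => by
    rw [Complex.exp_add, ← Complex.ofReal_exp, Real.exp_log hr]
  simp only [Complex.ofReal_re, Complex.ofReal_im, Complex.add_re, Complex.add_im, Complex.mul_re,
    Complex.mul_im, Complex.I_re, Complex.I_im, mul_zero, mul_one, zero_mul, sub_zero, add_zero,
    zero_add, Complex.ofReal_zero, e1, e2 _ _ hε, e2 _ _ hR, smul_eq_mul] at key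
  simp only [Complex.ofReal_add, Complex.ofReal_sub, Complex.ofReal_exp, ← sub_eq_add_neg] at key ⊢
  linear_combination key

/-- The boundary values of a bounded function that is holomorphic on the closed upper half plane
and tends to zero as `Im z → ∞` are an eigenfunction of the Hilbert transform. Decay along the real
line is not needed, as the integral over the large half circle vanishes in the limit by dominated
convergence. -/
theorem hasHilbertTransform_of_upperHalfPlane {F : ℂ → ℂ}
    (hd : ∀ z : ℂ, 0 ≤ z.im → DifferentiableAt ℂ F z) {C : ℝ}
    (hb : ∀ z : ℂ, 0 ≤ z.im → ‖F z‖ ≤ C) (hl : Tendsto F (comap Complex.im atTop) (𝓝 0)) (x : ℝ) :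
    HasHilbertTransform (fun y : ℝ => F y) x (Complex.I * F x) := by
  have hc : Continuous fun y : ℝ => F y := continuous_iff_continuousAt.2 fun y =>
    (hd y (by simp)).continuousAt.comp Complex.continuous_ofReal.continuousAt
  refine ⟨hc.locallyIntegrable, ?_⟩
  have him : ∀ r θ : ℝ, ((x : ℂ) + r * Complex.exp (θ * Complex.I)).im = r * Real.sin θ := by
    intro r θ
    simp [Complex.exp_ofReal_mul_I_im, Complex.exp_ofReal_mul_I_re]
  have hnn : ∀ r θ : ℝ, 0 ≤ r → θ ∈ Set.uIoc 0 Real.pi →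
      0 ≤ ((x : ℂ) + r * Complex.exp (θ * Complex.I)).im := by
    intro r θ hr hθ
    rw [Set.uIoc_of_le Real.pi_pos.le] at hθ
    rw [him]
    exact mul_nonneg hr (Real.sin_nonneg_of_nonneg_of_le_pi hθ.1.le hθ.2)
  have hmeas : ∀ r : ℝ, 0 ≤ r → AEStronglyMeasurable
      (fun θ : ℝ => F (x + r * Complex.exp (θ * Complex.I)))
      (volume.restrict (Set.uIoc 0 Real.pi)) := by
    intro r hr
    refine ContinuousOn.aestronglyMeasurable (fun θ hθ => ?_) measurableSet_uIoc
    refine ContinuousAt.continuousWithinAt ?_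
    exact ContinuousAt.comp (g := F) (hd _ (hnn r θ hr hθ)).continuousAt
      (by fun_prop)
  have hsmall : Tendsto
      (fun ε : ℝ => ∫ θ in (0 : ℝ)..Real.pi, F (x + ε * Complex.exp (θ * Complex.I)))
      (𝓝[>] 0) (𝓝 (∫ _ in (0 : ℝ)..Real.pi, F x)) := by
    refine intervalIntegral.tendsto_integral_filter_of_dominated_convergence (fun _ => C)
      ?_ ?_ intervalIntegrable_const ?_
    · filter_upwards [self_mem_nhdsWithin] with ε hε using hmeas ε (le_of_lt hε)
    · filter_upwards [self_mem_nhdsWithin] with ε hε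
      exact Eventually.of_forall fun θ hθ => hb _ (hnn ε θ (le_of_lt hε) hθ)
    · refine Eventually.of_forall fun θ _ => ?_
      refine Tendsto.mono_left ?_ nhdsWithin_le_nhds
      refine (hd x (by simp)).continuousAt.tendsto.comp ?_
      have : Continuous fun ε : ℝ => (x : ℂ) + ε * Complex.exp (θ * Complex.I) := by fun_prop
      simpa using this.tendsto 0
  have hlarge : Tendsto
      (fun R : ℝ => ∫ θ in (0 : ℝ)..Real.pi, F (x + R * Complex.exp (θ * Complex.I)))
      atTop (𝓝 (∫ _ in (0 : ℝ)..Real.pi, (0 : ℂ))) := by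
    refine intervalIntegral.tendsto_integral_filter_of_dominated_convergence (fun _ => C)
      ?_ ?_ intervalIntegrable_const ?_
    · filter_upwards [eventually_ge_atTop 0] with R hR using hmeas R hR
    · filter_upwards [eventually_ge_atTop 0] with R hR
      exact Eventually.of_forall fun θ hθ => hb _ (hnn R θ hR hθ)
    · -- At the endpoint `θ = π` the half circle meets the real line and there is no decay.
      have hae : ∀ᵐ θ : ℝ, θ ≠ Real.pi := by simp [ae_iff]
      filter_upwards [hae] with θ hθ hmem
      rw [Set.uIoc_of_le Real.pi_pos.le] at hmem
      refine hl.comp (tendsto_comap_iff.2 ?_)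
      have hs := Real.sin_pos_of_pos_of_lt_pi hmem.1 (lt_of_le_of_ne hmem.2 hθ)
      simpa only [Function.comp_def, him, id] using tendsto_id.atTop_mul_const hs
  have hpi : (Real.pi : ℂ) ≠ 0 := by exact_mod_cast Real.pi_ne_zero
  have hlim : Tendsto (fun p : ℝ × ℝ => (1 / (Real.pi : ℂ)) *
      (Complex.I * (∫ θ in (0 : ℝ)..Real.pi, F (x + p.1 * Complex.exp (θ * Complex.I))) -
        Complex.I * ∫ θ in (0 : ℝ)..Real.pi, F (x + p.2 * Complex.exp (θ * Complex.I))))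
      ((𝓝[>] (0 : ℝ)) ×ˢ atTop) (𝓝 (Complex.I * F x)) := by
    have hmul := (((hsmall.comp tendsto_fst).const_mul Complex.I).sub
      ((hlarge.comp (tendsto_snd (f := 𝓝[>] (0 : ℝ)))).const_mul Complex.I)).const_mul
        (1 / (Real.pi : ℂ))
    have hval : Complex.I * F x = 1 / (Real.pi : ℂ) * (Complex.I * (∫ _ in (0 : ℝ)..Real.pi, F x) -
        Complex.I * ∫ _ in (0 : ℝ)..Real.pi, (0 : ℂ)) := by
      simp only [intervalIntegral.integral_const, sub_zero, Complex.real_smul, smul_zero, mul_zero]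
      field_simp
    rw [hval]
    exact hmul
  refine hlim.congr' ?_
  have hev : ∀ᶠ p : ℝ × ℝ in (𝓝[>] (0 : ℝ)) ×ˢ atTop, (0 < p.1 ∧ p.1 < 1) ∧ 1 < p.2 :=
    Eventually.prod_mk (Ioo_mem_nhdsGT one_pos) (eventually_gt_atTop 1)
  filter_upwards [hev] with p hp
  rw [setIntegral_truncated_eq_arcs hd x hp.1.1 (hp.1.2.trans hp.2)]

/-- The Hilbert transform commutes with taking imaginary parts. -/
theorem HasHilbertTransform.im {F : ℝ → ℂ} (hF : Continuous F) {x : ℝ} {h : ℂ}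
    (hH : HasHilbertTransform F x h) :
    HasHilbertTransform (fun y => ((F y).im : ℂ)) x (h.im : ℂ) := by
  refine ⟨Continuous.locallyIntegrable (by fun_prop), ?_⟩
  have := (Complex.continuous_ofReal.comp Complex.continuous_im).continuousAt.tendsto.comp hH.2
  refine this.congr' ?_
  have hev : ∀ᶠ p : ℝ × ℝ in (𝓝[>] (0 : ℝ)) ×ˢ atTop, 0 < p.1 :=
    (tendsto_fst (g := (atTop : Filter ℝ))).eventually self_mem_nhdsWithin
  filter_upwards [hev] with p hp
  have hint : IntegrableOn (fun y : ℝ => F y / ((y : ℂ) - (x : ℂ)))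
      {y : ℝ | p.1 < |y - x| ∧ |y - x| < p.2} := by
    have hcpt : IsCompact {y : ℝ | p.1 ≤ |y - x| ∧ |y - x| ≤ p.2} := by
      refine (isCompact_closedBall x p.2).of_isClosed_subset ?_ fun y hy => hy.2
      have habs : Continuous fun y : ℝ => |y - x| := by fun_prop
      exact (isClosed_le continuous_const habs).inter (isClosed_le habs continuous_const)
    refine IntegrableOn.mono_set (ContinuousOn.integrableOn_compact hcpt ?_)
      fun y hy => ⟨hy.1.le, hy.2.le⟩
    refine hF.continuousOn.div (by fun_prop) ?_
    rintro y ⟨hy, -⟩ h0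
    rw [sub_eq_zero] at h0
    rw [Complex.ofReal_injective h0] at hy
    simp at hy
    linarith
  have h1 : ∀ y : ℝ, ((F y).im : ℂ) / ((y : ℂ) - (x : ℂ)) =
      (((F y / ((y : ℂ) - (x : ℂ))).im : ℝ) : ℂ) := by
    intro y
    rw [← Complex.ofReal_sub, Complex.div_ofReal_im, Complex.ofReal_div]
  simp only [h1, Function.comp_apply]
  have h2 : (1 / (Real.pi : ℂ)) = ((1 / Real.pi : ℝ) : ℂ) := by push_cast; rfl
  rw [h2, Complex.im_ofReal_mul, Complex.ofReal_mul, integral_complex_ofReal]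
  rw [← Complex.imCLM_apply, ← Complex.imCLM.integral_comp_comm hint]
  rfl

theorem HasHilbertTransform.const_mul {F : ℝ → ℂ} {x : ℝ} {h : ℂ}
    (hH : HasHilbertTransform F x h) (a : ℂ) :
    HasHilbertTransform (fun y => a * F y) x (a * h) := by
  refine ⟨hH.1.smul a, (hH.2.const_mul a).congr fun p => ?_⟩
  rw [mul_left_comm, ← integral_const_mul]
  simp only [mul_div_assoc]

/-! ### The common form of `f`, `f̃`, `g`, `g̃` and its derivatives -/

open Complex ComplexConjugate

theorem wave_eq_exp_mul (k c x₀ a : ℝ) (z : ℂ) (t : ℝ) :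
    wave k c x₀ a z t = (Real.exp a : ℂ) * wave k c x₀ 0 z t := by
  simp only [wave, ofReal_zero, add_zero, Complex.exp_add, ofReal_exp]
  ring

theorem wave_ne_zero (k c x₀ a : ℝ) (z : ℂ) (t : ℝ) : wave k c x₀ a z t ≠ 0 :=
  Complex.exp_ne_zero _

theorem norm_wave (k c x₀ a : ℝ) (z : ℂ) (t : ℝ) :
    ‖wave k c x₀ a z t‖ = Real.exp (a - k * z.im) := by
  rw [wave, Complex.norm_exp]
  simp [xi]
  ring

theorem conj_xi (c x₀ : ℝ) (z : ℂ) (t : ℝ) : conj (xi c x₀ (conj z) t) = xi c x₀ z t := by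
  simp [xi]

theorem conj_wave_zero (k c x₀ : ℝ) (z : ℂ) (t : ℝ) :
    conj (wave k c x₀ 0 (conj z) t) = (wave k c x₀ 0 z t)⁻¹ := by
  rw [wave, wave, ← Complex.exp_conj, ← Complex.exp_neg]
  congr 1
  rw [map_add, map_mul, map_mul, conj_xi]
  simp

/-- The function `(p + q ξ₂) (1 + m e^{i k₁ ξ₁}) + r (1 - m e^{i k₁ ξ₁})`, the common form of `f`,
`f̃`, `g` and `g̃`. -/
noncomputable def profile (p q r m : ℂ) (k₁ c₁ x₁ c₂ x₂ : ℝ) (z : ℂ) (t : ℝ) : ℂ :=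
  (p + q * xi c₂ x₂ z t) * (1 + m * wave k₁ c₁ x₁ 0 z t) + r * (1 - m * wave k₁ c₁ x₁ 0 z t)

/-- The first derivative of `profile` in `z`. -/
noncomputable def profileX (p q r m : ℂ) (k₁ c₁ x₁ c₂ x₂ : ℝ) (z : ℂ) (t : ℝ) : ℂ :=
  q * (1 + m * wave k₁ c₁ x₁ 0 z t) +
    (p + q * xi c₂ x₂ z t - r) * (I * k₁ * (m * wave k₁ c₁ x₁ 0 z t))

/-- The second derivative of `profile` in `z`. -/
noncomputable def profileXX (p q r m : ℂ) (k₁ c₁ x₁ c₂ x₂ : ℝ) (z : ℂ) (t : ℝ) : ℂ :=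
  2 * q * (I * k₁ * (m * wave k₁ c₁ x₁ 0 z t)) +
    (p + q * xi c₂ x₂ z t - r) * ((I * k₁) ^ 2 * (m * wave k₁ c₁ x₁ 0 z t))

/-- The derivative of `profile` in `t`. -/
noncomputable def profileT (p q r m : ℂ) (k₁ c₁ x₁ c₂ x₂ : ℝ) (z : ℂ) (t : ℝ) : ℂ :=
  -(q * c₂ * (1 + m * wave k₁ c₁ x₁ 0 z t)) -
    (p + q * xi c₂ x₂ z t - r) * (I * k₁ * c₁ * (m * wave k₁ c₁ x₁ 0 z t))

theorem hasDerivAt_xi (c x₀ : ℝ) (z : ℂ) (t : ℝ) : HasDerivAt (fun w => xi c x₀ w t) 1 z :=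
  ((hasDerivAt_id z).sub_const _).sub_const _

theorem hasDerivAt_xi_time (c x₀ : ℝ) (z : ℂ) (t : ℝ) :
    HasDerivAt (fun s : ℝ => xi c x₀ z s) (-(c : ℂ)) t := by
  simpa [xi] using
    (((ofRealCLM.hasDerivAt (x := t)).const_mul (c : ℂ)).const_sub z).sub_const (x₀ : ℂ)

theorem hasDerivAt_wave (k c x₀ : ℝ) (z : ℂ) (t : ℝ) :
    HasDerivAt (fun w => wave k c x₀ 0 w t) (I * k * wave k c x₀ 0 z t) z := by
  have := (((hasDerivAt_xi c x₀ z t).const_mul (I * (k : ℂ))).add_const ((0 : ℝ) : ℂ)).cexp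
  simpa only [wave, mul_one, mul_comm] using this

theorem hasDerivAt_wave_time (k c x₀ : ℝ) (z : ℂ) (t : ℝ) :
    HasDerivAt (fun s : ℝ => wave k c x₀ 0 z s) (-(I * k * c * wave k c x₀ 0 z t)) t := by
  have := (((hasDerivAt_xi_time c x₀ z t).const_mul (I * (k : ℂ))).add_const ((0 : ℝ) : ℂ)).cexp
  refine this.congr_deriv ?_
  simp only [wave]
  ring

section

variable (p q r m : ℂ) (k₁ c₁ x₁ c₂ x₂ : ℝ) (z : ℂ) (t : ℝ)

theorem hasDerivAt_profile : HasDerivAt (fun w => profile p q r m k₁ c₁ x₁ c₂ x₂ w t)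
    (profileX p q r m k₁ c₁ x₁ c₂ x₂ z t) z := by
  have hw := (hasDerivAt_wave k₁ c₁ x₁ z t).const_mul m
  have hx := ((hasDerivAt_xi c₂ x₂ z t).const_mul q).const_add p
  refine ((hx.mul (hw.const_add 1)).add ((hw.const_sub 1).const_mul r)).congr_deriv ?_
  simp only [profileX]
  ring

theorem hasDerivAt_profileX : HasDerivAt (fun w => profileX p q r m k₁ c₁ x₁ c₂ x₂ w t)
    (profileXX p q r m k₁ c₁ x₁ c₂ x₂ z t) z := by
  have hw := (hasDerivAt_wave k₁ c₁ x₁ z t).const_mul m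
  have hx := (((hasDerivAt_xi c₂ x₂ z t).const_mul q).const_add p).sub_const r
  refine (((hw.const_add 1).const_mul q).add (hx.mul (hw.const_mul (I * k₁)))).congr_deriv ?_
  simp only [profileXX]
  ring

theorem hasDerivAt_profile_time : HasDerivAt (fun s : ℝ => profile p q r m k₁ c₁ x₁ c₂ x₂ z s)
    (profileT p q r m k₁ c₁ x₁ c₂ x₂ z t) t := by
  have hw := (hasDerivAt_wave_time k₁ c₁ x₁ z t).const_mul m
  have hx := ((hasDerivAt_xi_time c₂ x₂ z t).const_mul q).const_add p
  refine ((hx.mul (hw.const_add 1)).add ((hw.const_sub 1).const_mul r)).congr_deriv ?_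
  simp only [profileT]
  ring

theorem differentiableAt_profileXX :
    DifferentiableAt ℂ (fun w => profileXX p q r m k₁ c₁ x₁ c₂ x₂ w t) z := by
  have hw := (hasDerivAt_wave k₁ c₁ x₁ z t).differentiableAt
  have hx := (hasDerivAt_xi c₂ x₂ z t).differentiableAt
  simp only [profileXX]
  fun_prop

theorem contDiff_profile :
    ContDiff ℝ 2 (fun s : ℝ × ℝ => profile p q r m k₁ c₁ x₁ c₂ x₂ (s.1 : ℂ) s.2) := by
  have h1 : ContDiff ℝ 2 (fun s : ℝ × ℝ => (s.1 : ℂ)) := ofRealCLM.contDiff.comp contDiff_fst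
  have h2 : ContDiff ℝ 2 (fun s : ℝ × ℝ => (s.2 : ℂ)) := ofRealCLM.contDiff.comp contDiff_snd
  simp only [profile, wave, xi]
  fun_prop

end

section

variable (σ k₁ c₁ x₁ c₂ x₂ φ ψ : ℝ) (z : ℂ) (t : ℝ)

theorem f_eq_profile : f σ k₁ c₁ x₁ c₂ x₂ φ z t =
    profile 1 (-(I * alph σ c₂)) (alph σ c₂ * bet k₁ c₁ c₂) (Real.exp φ : ℂ)⁻¹
      k₁ c₁ x₁ c₂ x₂ z t := by
  rw [f, profile, wave_eq_exp_mul, Real.exp_neg, ofReal_inv]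
  ring

theorem fTilde_eq_profile : fTilde σ k₁ c₁ x₁ c₂ x₂ φ z t =
    profile (-1) (-(I * alph σ c₂)) (alph σ c₂ * bet k₁ c₁ c₂) (Real.exp φ : ℂ)
      k₁ c₁ x₁ c₂ x₂ z t := by
  rw [fTilde, profile, wave_eq_exp_mul]
  ring

theorem g_eq_profile : g σ k₁ c₁ x₁ c₂ x₂ ψ z t = gam k₁ c₁ *
    profile (-(1 + σ * c₂)) (-(I * alph σ c₂)) (alph σ c₂ * bet k₁ c₁ c₂) (Real.exp ψ : ℂ)⁻¹
      k₁ c₁ x₁ c₂ x₂ z t := by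
  rw [g, profile, wave_eq_exp_mul, Real.exp_neg, ofReal_inv]
  ring

theorem gTilde_eq_profile : gTilde σ k₁ c₁ x₁ c₂ x₂ ψ z t = (gam k₁ c₁ : ℂ)⁻¹ *
    profile (1 + σ * c₂) (-(I * alph σ c₂)) (alph σ c₂ * bet k₁ c₁ c₂) (Real.exp ψ : ℂ)
      k₁ c₁ x₁ c₂ x₂ z t := by
  rw [gTilde, profile, wave_eq_exp_mul]
  ring

/-- Reflection in the real line turns the profile with parameters `p, m⁻¹` into the one with
`-p, m`, up to a nowhere vanishing exponential factor. -/
theorem profile_eq_conj (p α r m : ℝ) (hm : m ≠ 0) :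
    profile (-p) (-(I * α)) r m k₁ c₁ x₁ c₂ x₂ z t =
      -(m * wave k₁ c₁ x₁ 0 z t) *
        conj (profile p (-(I * α)) r (m : ℂ)⁻¹ k₁ c₁ x₁ c₂ x₂ (conj z) t) := by
  have hE := wave_ne_zero k₁ c₁ x₁ 0 z t
  have hm' : (m : ℂ) ≠ 0 := by exact_mod_cast hm
  simp only [profile, map_add, map_mul, map_sub, map_neg, map_one, map_inv₀, conj_ofReal, conj_I,
    conj_xi, conj_wave_zero]
  field_simp
  ring

theorem profileX_eq_conj (p α r m : ℝ) (hm : m ≠ 0) :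
    profileX (-p) (-(I * α)) r m k₁ c₁ x₁ c₂ x₂ z t =
      -(m * wave k₁ c₁ x₁ 0 z t) *
        (I * k₁ * conj (profile p (-(I * α)) r (m : ℂ)⁻¹ k₁ c₁ x₁ c₂ x₂ (conj z) t) +
          conj (profileX p (-(I * α)) r (m : ℂ)⁻¹ k₁ c₁ x₁ c₂ x₂ (conj z) t)) := by
  have hE := wave_ne_zero k₁ c₁ x₁ 0 z t
  have hm' : (m : ℂ) ≠ 0 := by exact_mod_cast hm
  simp only [profile, profileX, map_add, map_mul, map_sub, map_neg, map_one, map_inv₀, conj_ofReal,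
    conj_I, conj_xi, conj_wave_zero]
  field_simp
  ring

end

/-! ### Bilinear identities -/

section

variable {k₁ c₁ c₂ σ : ℝ}

theorem two_mul_alph : 2 * (alph σ c₂ : ℂ) = -(σ * c₂ * (c₂ + 2 * σ)) := by
  rw [alph]; push_cast; ring

theorem alph_mul_bet (hβ : (c₁ - c₂) ^ 2 - k₁ ^ 2 ≠ 0) :
    (alph σ c₂ * bet k₁ c₁ c₂ : ℂ) * ((c₁ - c₂) ^ 2 - k₁ ^ 2) = 2 * k₁ * alph σ c₂ := by
  have hβ' : ((c₁ : ℂ) - c₂) ^ 2 - (k₁ : ℂ) ^ 2 ≠ 0 := by exact_mod_cast hβ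
  rw [bet]; push_cast; field_simp

/-- The polynomial identity behind `bilinear_evolution`. Here `α`, `r` stand for `α₂`, `α₂ β₁₂`,
the variable `Y` for `i ξ₂`, and `M`, `N` for the exponentials in `f` and `g`, which are multiples
of one variable `V`; the powers of `i` produced by differentiation have been divided out. -/
theorem evolution_identity {s k c d α r : ℂ} (hs : s = 1 ∨ s = -1)
    (hα : 2 * α = -(s * d * (d + 2 * s))) (hr : r * ((c - d) ^ 2 - k ^ 2) = 2 * k * α) (Y V : ℂ) :
    let M := (c + k) * V
    let N := (c - k) * V
    let P := 1 - α * Y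
    let Q := -(1 + s * d) - α * Y
    (α * d * (1 + N) - (Q - r) * (k * c * N)) * (P * (1 + M) + r * (1 - M)) -
        (Q * (1 + N) + r * (1 - N)) * (α * d * (1 + M) - (P - r) * (k * c * M)) =
      (-2 * α * (k * N) + (Q - r) * (k ^ 2 * N)) * (P * (1 + M) + r * (1 - M)) -
        2 * (-α * (1 + N) + (Q - r) * (k * N)) * (-α * (1 + M) + (P - r) * (k * M)) +
        (Q * (1 + N) + r * (1 - N)) * (-2 * α * (k * M) + (P - r) * (k ^ 2 * M)) := by
  intro M N P Q
  rcases hs with rfl | rfl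
  · linear_combination (α * (1 + M * N) + V * (2 * c * α + 2 * r * k * (2 * c - d))) * hα +
      2 * k * (2 + d) * V * hr
  · linear_combination (α * (1 + M * N) + V * (2 * c * α + 2 * r * k * (2 * c - d))) * hα +
      2 * k * (2 - d) * V * hr

/-- The polynomial identity behind `bilinear_density`, in the notation of `evolution_identity`.
Here `M`, `N`, `M'`, `N'` stand for the exponentials in `f`, `f̃`, `g`, `g̃`. -/
theorem density_identity {s k c d α r : ℂ} (hs : s = 1 ∨ s = -1)
    (hα : 2 * α = -(s * d * (d + 2 * s))) (hr : r * ((c - d) ^ 2 - k ^ 2) = 2 * k * α) (Y V : ℂ) :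
    let M := (c + k) * (c - k + 2 * s) * V
    let N := (c - k) * (c + k + 2 * s) * V
    let M' := (c - k) * (c - k + 2 * s) * V
    let N' := (c + k) * (c + k + 2 * s) * V
    ((-(1 + s * d) - α * Y) * (1 + M') + r * (1 - M')) *
        ((1 + s * d - α * Y) * (1 + N') + r * (1 - N')) =
      ((1 - α * Y) * (1 + M) + r * (1 - M)) * ((-1 - α * Y) * (1 + N) + r * (1 - N)) +
        s * ((-α * (1 + M) + (1 - α * Y - r) * (k * M)) * ((-1 - α * Y) * (1 + N) + r * (1 - N)) -
          ((1 - α * Y) * (1 + M) + r * (1 - M)) *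
            (-α * (1 + N) + (-1 - α * Y - r) * (k * N))) := by
  intro M N M' N'
  rcases hs with rfl | rfl
  · linear_combination (-(1 + M * N) - V * (2 * c ^ 2 + 2 * k ^ 2 + 4 * c) + 4 * r * k * V) * hα -
      4 * k * V * hr
  · linear_combination ((1 + M * N) + V * (2 * c ^ 2 + 2 * k ^ 2 - 4 * c) + 4 * r * k * V) * hα +
      4 * k * V * hr

/-- The bilinear form `i (g_t f - g f_t) = g_xx f - 2 g_x f_x + g f_xx` of the evolution
equation. -/
theorem bilinear_evolution (hσ : σ = 1 ∨ σ = -1) (h1 : c₁ + k₁ ≠ 0)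
    (hβ : (c₁ - c₂) ^ 2 - k₁ ^ 2 ≠ 0) {m n : ℂ} (hmn : n * (c₁ + k₁) = m * (c₁ - k₁))
    (x₁ x₂ : ℝ) (z : ℂ) (t : ℝ) :
    let G := fun P : ℂ → ℂ → ℂ → ℂ → ℝ → ℝ → ℝ → ℝ → ℝ → ℂ → ℝ → ℂ =>
      P (-(1 + σ * c₂)) (-(I * alph σ c₂)) (alph σ c₂ * bet k₁ c₁ c₂) n k₁ c₁ x₁ c₂ x₂ z t
    let F := fun P : ℂ → ℂ → ℂ → ℂ → ℝ → ℝ → ℝ → ℝ → ℝ → ℂ → ℝ → ℂ =>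
      P 1 (-(I * alph σ c₂)) (alph σ c₂ * bet k₁ c₁ c₂) m k₁ c₁ x₁ c₂ x₂ z t
    I * (G profileT * F profile - G profile * F profileT) =
      G profileXX * F profile - 2 * G profileX * F profileX + G profile * F profileXX := by
  intro G F
  have h1' : (c₁ : ℂ) + k₁ ≠ 0 := by exact_mod_cast h1
  obtain ⟨μ, rfl⟩ : ∃ μ, m = (c₁ + k₁) * μ := ⟨m / (c₁ + k₁), by field_simp⟩
  have hn : n = (c₁ - k₁) * μ := mul_right_cancel₀ h1' (by rw [hmn]; ring)
  have key := evolution_identity (s := σ) (by exact_mod_cast hσ) (two_mul_alph (c₂ := c₂))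
    (alph_mul_bet hβ) (I * xi c₂ x₂ z t) (μ * wave k₁ c₁ x₁ 0 z t)
  simp only [G, F, profile, profileX, profileXX, profileT, hn]
  linear_combination I ^ 2 * key

/-- The bilinear form `g g̃ = f f̃ - i σ (f_x f̃ - f f̃_x)` of the formula for the density
`|u|²`. -/
theorem bilinear_density (hσ : σ = 1 ∨ σ = -1) (h1 : c₁ + k₁ ≠ 0) (h2 : c₁ - k₁ ≠ 0)
    (h3 : c₁ - k₁ + 2 * σ ≠ 0) (hβ : (c₁ - c₂) ^ 2 - k₁ ^ 2 ≠ 0) {a b : ℝ} (ha : a ≠ 0)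
    (hab : b = (c₁ + k₁) / (c₁ - k₁) * a)
    (haa : a ^ 2 = ((c₁ - k₁) * (c₁ + k₁ + 2 * σ)) / ((c₁ + k₁) * (c₁ - k₁ + 2 * σ)))
    (x₁ x₂ : ℝ) (z : ℂ) (t : ℝ) :
    let q : ℂ := -(I * alph σ c₂)
    let r : ℂ := alph σ c₂ * bet k₁ c₁ c₂
    profile (-(1 + σ * c₂)) q r (b : ℂ)⁻¹ k₁ c₁ x₁ c₂ x₂ z t *
        profile (1 + σ * c₂) q r b k₁ c₁ x₁ c₂ x₂ z t =
      profile 1 q r (a : ℂ)⁻¹ k₁ c₁ x₁ c₂ x₂ z t * profile (-1) q r a k₁ c₁ x₁ c₂ x₂ z t -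
        I * σ * (profileX 1 q r (a : ℂ)⁻¹ k₁ c₁ x₁ c₂ x₂ z t *
            profile (-1) q r a k₁ c₁ x₁ c₂ x₂ z t -
          profile 1 q r (a : ℂ)⁻¹ k₁ c₁ x₁ c₂ x₂ z t *
            profileX (-1) q r a k₁ c₁ x₁ c₂ x₂ z t) := by
  intro q r
  have h1' : (c₁ : ℂ) + k₁ ≠ 0 := by exact_mod_cast h1
  have h2' : (c₁ : ℂ) - k₁ ≠ 0 := by exact_mod_cast h2
  have h3' : (c₁ : ℂ) - k₁ + 2 * σ ≠ 0 := by exact_mod_cast h3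
  have ha' : (a : ℂ) ≠ 0 := by exact_mod_cast ha
  have hA : (a : ℂ) ^ 2 =
      ((c₁ - k₁) * (c₁ + k₁ + 2 * σ)) / ((c₁ + k₁) * (c₁ - k₁ + 2 * σ)) := by
    exact_mod_cast congrArg ofReal haa
  -- The four exponentials are polynomial multiples of one variable `V`.
  obtain ⟨V, hV⟩ : ∃ V, wave k₁ c₁ x₁ 0 z t = a * ((c₁ + k₁) * (c₁ - k₁ + 2 * σ) * V) :=
    ⟨wave k₁ c₁ x₁ 0 z t / (a * ((c₁ + k₁) * (c₁ - k₁ + 2 * σ))), by field_simp⟩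
  have e1 : (a : ℂ)⁻¹ * wave k₁ c₁ x₁ 0 z t = (c₁ + k₁) * (c₁ - k₁ + 2 * σ) * V := by
    rw [hV]; field_simp
  have e2 : (a : ℂ) * wave k₁ c₁ x₁ 0 z t = (c₁ - k₁) * (c₁ + k₁ + 2 * σ) * V := by
    rw [hV, ← mul_assoc, ← pow_two, hA]; field_simp
  have e3 : (b : ℂ)⁻¹ * wave k₁ c₁ x₁ 0 z t = (c₁ - k₁) * (c₁ - k₁ + 2 * σ) * V := by
    rw [hV, hab]; push_cast; field_simp
  have e4 : (b : ℂ) * wave k₁ c₁ x₁ 0 z t = (c₁ + k₁) * (c₁ + k₁ + 2 * σ) * V := by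
    have : (b : ℂ) * wave k₁ c₁ x₁ 0 z t =
        (c₁ + k₁) / (c₁ - k₁) * (a * wave k₁ c₁ x₁ 0 z t) := by
      rw [hab]; push_cast; ring
    rw [this, e2]; field_simp
  have key := density_identity (s := σ) (by exact_mod_cast hσ) (two_mul_alph (c₂ := c₂))
    (alph_mul_bet hβ) (I * xi c₂ x₂ z t) V
  simp only at key
  simp only [profile, profileX, e1, e2, e3, e4]
  set M := ((c₁ : ℂ) + k₁) * (c₁ - k₁ + 2 * σ) * V
  set N := ((c₁ : ℂ) - k₁) * (c₁ + k₁ + 2 * σ) * V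
  set M' := ((c₁ : ℂ) - k₁) * (c₁ - k₁ + 2 * σ) * V
  set N' := ((c₁ : ℂ) + k₁) * (c₁ + k₁ + 2 * σ) * V
  set Y := I * xi c₂ x₂ z t
  set α : ℂ := (alph σ c₂ : ℂ)
  have hq : q * xi c₂ x₂ z t = -(α * Y) := by simp only [q, Y]; ring
  simp only [hq]
  simp only [q]
  linear_combination key + σ *
    ((-α * (1 + M) + (1 - α * Y - r) * (k₁ * M)) * ((-1 - α * Y) * (1 + N) + r * (1 - N)) -
      ((1 - α * Y) * (1 + M) + r * (1 - M)) * (-α * (1 + N) + (-1 - α * Y - r) * (k₁ * N))) * I_sq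

end

/-! ### Estimates in the closed upper half plane -/

theorem one_add_ne_zero_of_norm_lt_one {w : ℂ} (hw : ‖w‖ < 1) : 1 + w ≠ 0 := by
  intro h
  rw [← neg_eq_iff_add_eq_zero] at h
  rw [← h] at hw
  simp at hw

theorem re_one_sub_div_one_add_nonneg {w : ℂ} (hw : ‖w‖ < 1) : 0 ≤ ((1 - w) / (1 + w)).re := by
  have h1 : w.re * w.re + w.im * w.im < 1 := by
    rw [← normSq_apply, ← Complex.sq_norm]
    nlinarith [norm_nonneg w]
  rw [div_re, ← add_div]
  refine div_nonneg ?_ (normSq_nonneg _)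
  simp only [sub_re, add_re, one_re, sub_im, add_im, one_im]
  nlinarith

theorem norm_mul_wave_le {k₁ m : ℝ} (hk : 0 < k₁) (hm : 0 < m) (c₁ x₁ : ℝ) {z : ℂ}
    (hz : 0 ≤ z.im) (t : ℝ) : ‖(m : ℂ) * wave k₁ c₁ x₁ 0 z t‖ ≤ m := by
  rw [norm_mul, norm_wave, norm_real, Real.norm_of_nonneg hm.le]
  refine mul_le_of_le_one_right hm.le (Real.exp_le_one_iff.2 ?_)
  nlinarith

theorem one_sub_le_norm_one_add {w : ℂ} {m : ℝ} (hw : ‖w‖ ≤ m) : 1 - m ≤ ‖1 + w‖ := by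
  have := norm_sub_le (1 + w) w
  rw [add_sub_cancel_right, norm_one] at this
  linarith

section

variable {α r m k₁ : ℝ} (c₁ x₁ c₂ x₂ : ℝ) {z : ℂ}

/-- Dividing by `1 + w` with `w = m e^{i k₁ ξ₁}` leaves a function with real part at least
`1 + α Im z`, because the Cayley transform `(1 - w) / (1 + w)` maps the unit disk into the right
half plane. -/
theorem le_norm_profile (hα : 0 ≤ α) (hr : 0 ≤ r) (hk : 0 < k₁) (hm : 0 < m) (hm1 : m < 1)
    (hz : 0 ≤ z.im) (t : ℝ) :
    (1 - m) * (1 + α * z.im) ≤ ‖profile 1 (-(I * α)) r m k₁ c₁ x₁ c₂ x₂ z t‖ := by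
  set w := (m : ℂ) * wave k₁ c₁ x₁ 0 z t with hwdef
  have hw : ‖w‖ ≤ m := norm_mul_wave_le hk hm c₁ x₁ hz t
  have h1 : 1 + w ≠ 0 := one_add_ne_zero_of_norm_lt_one (hw.trans_lt hm1)
  have heq : profile 1 (-(I * α)) r m k₁ c₁ x₁ c₂ x₂ z t =
      (1 + w) * (1 - I * α * xi c₂ x₂ z t + r * ((1 - w) / (1 + w))) := by
    rw [profile, ← hwdef]
    field_simp
    ring
  rw [heq, norm_mul]
  refine mul_le_mul (one_sub_le_norm_one_add hw) ?_ (by positivity) (norm_nonneg _)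
  refine le_trans ?_ (re_le_norm _)
  have h2 := mul_nonneg hr (re_one_sub_div_one_add_nonneg (hw.trans_lt hm1))
  rw [add_re, re_ofReal_mul]
  simp only [sub_re, one_re, mul_re, I_re, I_im, ofReal_re, ofReal_im, mul_im, xi, sub_im]
  linarith

theorem profile_ne_zero (hα : 0 ≤ α) (hr : 0 ≤ r) (hk : 0 < k₁) (hm : 0 < m) (hm1 : m < 1)
    (hz : 0 ≤ z.im) (t : ℝ) : profile 1 (-(I * α)) r m k₁ c₁ x₁ c₂ x₂ z t ≠ 0 := by
  rw [← norm_pos_iff]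
  refine lt_of_lt_of_le ?_ (le_norm_profile c₁ x₁ c₂ x₂ hα hr hk hm hm1 hz t)
  have : 0 < 1 - m := by linarith
  positivity

end

/-! ### The second logarithmic derivative -/

/-- The second derivative in `z` of the logarithm of `profile`. -/
noncomputable def profileLogXX (p q r m : ℂ) (k₁ c₁ x₁ c₂ x₂ : ℝ) (z : ℂ) (t : ℝ) : ℂ :=
  (profileXX p q r m k₁ c₁ x₁ c₂ x₂ z t * profile p q r m k₁ c₁ x₁ c₂ x₂ z t -
    profileX p q r m k₁ c₁ x₁ c₂ x₂ z t * profileX p q r m k₁ c₁ x₁ c₂ x₂ z t) /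
      profile p q r m k₁ c₁ x₁ c₂ x₂ z t ^ 2

section

variable {p q r m : ℂ} {k₁ c₁ x₁ c₂ x₂ : ℝ} {z : ℂ} {t : ℝ}

theorem hasDerivAt_profileX_div (h : profile p q r m k₁ c₁ x₁ c₂ x₂ z t ≠ 0) :
    HasDerivAt (fun w => profileX p q r m k₁ c₁ x₁ c₂ x₂ w t / profile p q r m k₁ c₁ x₁ c₂ x₂ w t)
      (profileLogXX p q r m k₁ c₁ x₁ c₂ x₂ z t) z :=
  (hasDerivAt_profileX p q r m k₁ c₁ x₁ c₂ x₂ z t).div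
    (hasDerivAt_profile p q r m k₁ c₁ x₁ c₂ x₂ z t) h

theorem differentiableAt_profileLogXX (h : profile p q r m k₁ c₁ x₁ c₂ x₂ z t ≠ 0) :
    DifferentiableAt ℂ (fun w => profileLogXX p q r m k₁ c₁ x₁ c₂ x₂ w t) z := by
  have h0 := (hasDerivAt_profile p q r m k₁ c₁ x₁ c₂ x₂ z t).differentiableAt
  have h1 := (hasDerivAt_profileX p q r m k₁ c₁ x₁ c₂ x₂ z t).differentiableAt
  have h2 := differentiableAt_profileXX p q r m k₁ c₁ x₁ c₂ x₂ z t
  exact ((h2.mul h0).sub (h1.mul h1)).div (h0.pow 2) (pow_ne_zero 2 h)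

/-- A polynomial expression for `profileLogXX` in `w = m e^{i k₁ ξ₁}`, `s = (1 + w)⁻¹` and the
reciprocal `v` of `profile`. Each of its terms contains `w` or `v`. -/
noncomputable def logXXPoly (q r : ℂ) (k : ℝ) (y : ℂ × ℂ × ℂ) : ℂ :=
  -(k ^ 2 * y.1 * y.2.1 ^ 2) + (I * k * q * y.1 + 2 * r * k ^ 2 * y.1 * y.2.1 ^ 2) * y.2.2 -
    (q * (1 + y.1) - 2 * r * (I * k) * y.1 * y.2.1) * y.2.2 *
      (I * k * y.1 * y.2.1 + (q * (1 + y.1) - 2 * r * (I * k) * y.1 * y.2.1) * y.2.2)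

theorem continuous_logXXPoly (q r : ℂ) (k : ℝ) : Continuous (logXXPoly q r k) := by
  unfold logXXPoly
  fun_prop

theorem profileLogXX_eq_logXXPoly (h : profile p q r m k₁ c₁ x₁ c₂ x₂ z t ≠ 0)
    (hw : 1 + m * wave k₁ c₁ x₁ 0 z t ≠ 0) :
    profileLogXX p q r m k₁ c₁ x₁ c₂ x₂ z t =
      logXXPoly q r k₁ (m * wave k₁ c₁ x₁ 0 z t, (1 + m * wave k₁ c₁ x₁ 0 z t)⁻¹,
        (profile p q r m k₁ c₁ x₁ c₂ x₂ z t)⁻¹) := by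
  simp only [profileLogXX, logXXPoly, profileX, profileXX]
  -- Eliminate the unbounded factor `p + q ξ₂` in favour of the profile itself.
  have hT : p + q * xi c₂ x₂ z t = (profile p q r m k₁ c₁ x₁ c₂ x₂ z t -
      r * (1 - m * wave k₁ c₁ x₁ 0 z t)) / (1 + m * wave k₁ c₁ x₁ 0 z t) := by
    rw [eq_div_iff hw, profile]; ring
  rw [hT]
  generalize profile p q r m k₁ c₁ x₁ c₂ x₂ z t = F at *
  generalize m * wave k₁ c₁ x₁ 0 z t = w at *
  obtain ⟨i, hi⟩ : ∃ i, i = I * (k₁ : ℂ) := ⟨_, rfl⟩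
  have hk : (k₁ : ℂ) ^ 2 = -i ^ 2 := by rw [hi, mul_pow, I_sq]; ring
  simp only [← hi, hk]
  field_simp
  ring

end

section

variable {α r m k₁ : ℝ} (c₁ x₁ c₂ x₂ : ℝ)

theorem exists_bound_profileLogXX (hα : 0 ≤ α) (hr : 0 ≤ r) (hk : 0 < k₁) (hm : 0 < m)
    (hm1 : m < 1) (t : ℝ) :
    ∃ C, ∀ z : ℂ, 0 ≤ z.im → ‖profileLogXX 1 (-(I * α)) r m k₁ c₁ x₁ c₂ x₂ z t‖ ≤ C := by
  have h1m : 0 < 1 - m := by linarith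
  obtain ⟨C, hC⟩ := ((isCompact_closedBall (0 : ℂ) m).prod
    ((isCompact_closedBall (0 : ℂ) (1 - m)⁻¹).prod
      (isCompact_closedBall (0 : ℂ) (1 - m)⁻¹))).exists_bound_of_continuousOn
        (continuous_logXXPoly (-(I * α)) r k₁).continuousOn
  refine ⟨C, fun z hz => ?_⟩
  have hw := norm_mul_wave_le hk hm c₁ x₁ hz t
  rw [profileLogXX_eq_logXXPoly (profile_ne_zero c₁ x₁ c₂ x₂ hα hr hk hm hm1 hz t)
    (one_add_ne_zero_of_norm_lt_one (hw.trans_lt hm1))]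
  refine hC _ ⟨by simpa using hw, ?_, ?_⟩
  · rw [mem_closedBall_zero_iff, norm_inv]
    exact inv_anti₀ h1m (one_sub_le_norm_one_add hw)
  · rw [mem_closedBall_zero_iff, norm_inv]
    refine inv_anti₀ h1m (le_trans ?_ (le_norm_profile c₁ x₁ c₂ x₂ hα hr hk hm hm1 hz t))
    exact le_mul_of_one_le_right h1m.le (by nlinarith)

theorem tendsto_profileLogXX (hα : 0 < α) (hr : 0 ≤ r) (hk : 0 < k₁) (hm : 0 < m)
    (hm1 : m < 1) (t : ℝ) :
    Tendsto (fun z => profileLogXX 1 (-(I * α)) r m k₁ c₁ x₁ c₂ x₂ z t)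
      (comap Complex.im atTop) (𝓝 0) := by
  have h1m : 0 < 1 - m := by linarith
  have him : Tendsto Complex.im (comap Complex.im atTop) atTop := tendsto_comap
  have hpos : ∀ᶠ z : ℂ in comap Complex.im atTop, 0 ≤ z.im := him.eventually_ge_atTop 0
  have hw : Tendsto (fun z : ℂ => (m : ℂ) * wave k₁ c₁ x₁ 0 z t) (comap Complex.im atTop)
      (𝓝 0) := by
    rw [tendsto_zero_iff_norm_tendsto_zero]
    have h2 : Tendsto (fun z : ℂ => m * Real.exp (0 - k₁ * z.im)) (comap Complex.im atTop)
        (𝓝 (m * 0)) := by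
      refine Tendsto.const_mul m (Real.tendsto_exp_atBot.comp ?_)
      simp only [zero_sub]
      exact tendsto_neg_atTop_atBot.comp (him.const_mul_atTop hk)
    rw [mul_zero] at h2
    refine h2.congr fun z => ?_
    rw [norm_mul, norm_wave, norm_real, Real.norm_of_nonneg hm.le]
  have hv : Tendsto (fun z : ℂ => (profile 1 (-(I * α)) r m k₁ c₁ x₁ c₂ x₂ z t)⁻¹)
      (comap Complex.im atTop) (𝓝 0) := by
    refine tendsto_inv₀_cobounded.comp (tendsto_norm_atTop_iff_cobounded.1 ?_)
    refine tendsto_atTop_mono' _ ?_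
      ((tendsto_atTop_add_const_left _ 1 (him.const_mul_atTop hα)).const_mul_atTop h1m)
    filter_upwards [hpos] with z hz
    exact le_norm_profile c₁ x₁ c₂ x₂ hα.le hr hk hm hm1 hz t
  have hs := (hw.const_add 1).inv₀ (by simp)
  have hlim := ((continuous_logXXPoly (-(I * α)) r k₁).tendsto _).comp
    (hw.prodMk_nhds (hs.prodMk_nhds hv))
  have h0 : logXXPoly (-(I * α)) r k₁ (0, (1 + 0)⁻¹, 0) = 0 := by simp [logXXPoly]
  rw [h0] at hlim
  refine hlim.congr' ?_
  filter_upwards [hpos] with z hz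
  exact (profileLogXX_eq_logXXPoly (profile_ne_zero c₁ x₁ c₂ x₂ hα.le hr hk hm hm1 hz t)
    (one_add_ne_zero_of_norm_lt_one
      ((norm_mul_wave_le hk hm c₁ x₁ hz t).trans_lt hm1))).symm

theorem hasHilbertTransform_profileLogXX (hα : 0 < α) (hr : 0 ≤ r) (hk : 0 < k₁) (hm : 0 < m)
    (hm1 : m < 1) (t x : ℝ) :
    HasHilbertTransform (fun y : ℝ => ((profileLogXX 1 (-(I * α)) r m k₁ c₁ x₁ c₂ x₂ y t).im : ℂ))
      x ((profileLogXX 1 (-(I * α)) r m k₁ c₁ x₁ c₂ x₂ x t).re : ℂ) := by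
  have hd : ∀ z : ℂ, 0 ≤ z.im →
      DifferentiableAt ℂ (fun w => profileLogXX 1 (-(I * α)) r m k₁ c₁ x₁ c₂ x₂ w t) z :=
    fun z hz => differentiableAt_profileLogXX
      (profile_ne_zero c₁ x₁ c₂ x₂ hα.le hr hk hm hm1 hz t)
  obtain ⟨C, hC⟩ := exists_bound_profileLogXX c₁ x₁ c₂ x₂ hα.le hr hk hm hm1 t
  have hH := hasHilbertTransform_of_upperHalfPlane hd hC
    (tendsto_profileLogXX c₁ x₁ c₂ x₂ hα hr hk hm hm1 t) x
  have hc : Continuous fun y : ℝ => profileLogXX 1 (-(I * α)) r m k₁ c₁ x₁ c₂ x₂ y t :=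
    continuous_iff_continuousAt.2 fun y =>
      (hd y (by simp)).continuousAt.comp continuous_ofReal.continuousAt
  simpa using hH.im hc

end

/-! ### Parameters -/

theorem AdmissibleWave.sign_cases {σ k c : ℝ} (h : AdmissibleWave σ k c) : σ = 1 ∨ σ = -1 := by
  rcases h with ⟨h, -⟩ | ⟨h, -⟩ <;> simp [h]

theorem AdmissibleWave.wavenumber_pos {σ k c : ℝ} (h : AdmissibleWave σ k c) : 0 < k := by
  rcases h with ⟨-, h, -⟩ | ⟨-, h, -⟩ <;> exact h

theorem AdmissibleWave.signs {σ k c : ℝ} (h : AdmissibleWave σ k c) :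
    0 < (c + k) * (c - k) ∧ σ * ((c + k) * (c - k + 2 * σ)) < 0 := by
  rcases h with ⟨rfl, h0, h1, h2, h3⟩ | ⟨rfl, h0, h1 | h1⟩
  · refine ⟨mul_pos_of_neg_of_neg (by linarith) (by linarith), ?_⟩
    rw [one_mul]; exact mul_neg_of_neg_of_pos (by linarith) (by linarith)
  · refine ⟨mul_pos (by linarith) (by linarith), ?_⟩
    rw [neg_one_mul, neg_lt_zero]; exact mul_pos (by linarith) (by linarith)
  · refine ⟨mul_pos_of_neg_of_neg (by linarith) (by linarith), ?_⟩
    rw [neg_one_mul, neg_lt_zero]; exact mul_pos_of_neg_of_neg (by linarith) (by linarith)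

theorem AdmissibleWave.ratio_pos {σ k c : ℝ} (h : AdmissibleWave σ k c) :
    0 < (c + k) / (c - k) := by
  rw [div_pos_iff, ← mul_pos_iff]
  exact h.signs.1

theorem AdmissibleWave.gam_pos {σ k c : ℝ} (h : AdmissibleWave σ k c) : 0 < gam k c :=
  Real.sqrt_pos.2 h.ratio_pos

/-- The numerator of the formula for `e^{2φ}` minus its denominator is `-4 σ k`, and the
denominator has the sign of `-σ`. -/
theorem AdmissibleWave.one_lt_phase {σ k c : ℝ} (h : AdmissibleWave σ k c) :
    1 < ((c - k) * (c + k + 2 * σ)) / ((c + k) * (c - k + 2 * σ)) := by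
  have hk := h.wavenumber_pos
  have h2 := h.signs.2
  rcases h.sign_cases with rfl | rfl
  · rw [one_mul] at h2
    rw [one_lt_div_of_neg h2]
    linarith
  · rw [neg_one_mul, neg_lt_zero] at h2
    rw [one_lt_div h2]
    linarith

theorem AdmissibleWave.existsUnique_phase {σ k c : ℝ} (h : AdmissibleWave σ k c) :
    ∃! p : ℝ × ℝ, IsPhase σ k c p.1 p.2 := by
  have h1 := h.one_lt_phase
  have h2 := h.ratio_pos
  set R := ((c - k) * (c + k + 2 * σ)) / ((c + k) * (c - k + 2 * σ)) with hR
  refine ⟨(Real.log R / 2, Real.log ((c + k) / (c - k)) + Real.log R / 2),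
    ⟨by have := Real.log_pos h1; positivity, ?_, ?_⟩, ?_⟩
  · rw [← hR, mul_div_cancel₀ _ (two_ne_zero' ℝ), Real.exp_log (by linarith)]
  · rw [Real.exp_add, Real.exp_log h2]
  · rintro ⟨φ, ψ⟩ ⟨-, hφ, hψ⟩
    rw [← hR] at hφ
    have e1 : φ = Real.log R / 2 := by rw [← hφ, Real.log_exp]; ring
    have e2 : ψ = Real.log ((c + k) / (c - k)) + φ := by
      rw [← Real.log_exp ψ, hψ, Real.log_mul h2.ne' (Real.exp_pos φ).ne', Real.log_exp]
    rw [e2, e1]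

theorem bet_pos_iff {k₁ c₁ c₂ : ℝ} (hk : 0 < k₁) :
    0 < bet k₁ c₁ c₂ ↔ c₂ < c₁ - k₁ ∨ c₁ + k₁ < c₂ := by
  have h2k : 0 < 2 * k₁ := by linarith
  rw [bet, div_pos_iff_of_pos_left h2k, sub_pos, sq_lt_sq, abs_of_pos hk, lt_abs]
  constructor <;> rintro (h | h)
  · left; linarith
  · right; linarith
  · left; linarith
  · right; linarith

theorem alph_one_pos_iff {c₂ : ℝ} : 0 < alph 1 c₂ ↔ -2 < c₂ ∧ c₂ < 0 := by
  have : alph 1 c₂ = 1 / 2 * (-c₂ * (c₂ + 2)) := by rw [alph]; ring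
  rw [this, mul_pos_iff_of_pos_left (by norm_num), mul_pos_iff]
  constructor
  · rintro (⟨h1, h2⟩ | ⟨h1, h2⟩) <;> constructor <;> linarith
  · rintro ⟨h1, h2⟩; left; constructor <;> linarith

theorem alph_neg_one_pos_iff {c₂ : ℝ} : 0 < alph (-1) c₂ ↔ c₂ < 0 ∨ 2 < c₂ := by
  have : alph (-1) c₂ = 1 / 2 * (c₂ * (c₂ - 2)) := by rw [alph]; ring
  rw [this, mul_pos_iff_of_pos_left (by norm_num), mul_pos_iff]
  constructor
  · rintro (⟨h1, h2⟩ | ⟨h1, h2⟩)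
    · right; linarith
    · left; linarith
  · rintro (h | h)
    · right; constructor <;> linarith
    · left; constructor <;> linarith

theorem AdmissibleWave.admissibleSpeed_iff {σ k₁ c₁ : ℝ} (h : AdmissibleWave σ k₁ c₁) (c₂ : ℝ) :
    AdmissibleSpeed σ k₁ c₁ c₂ ↔ (0 < alph σ c₂ ∧ 0 < bet k₁ c₁ c₂) := by
  rw [bet_pos_iff h.wavenumber_pos]
  have hne : ¬ (1 : ℝ) = -1 := by norm_num
  have hne' : ¬ (-1 : ℝ) = 1 := by norm_num
  rcases h with ⟨rfl, h0, h1, h2, h3⟩ | ⟨rfl, h0, h1 | h1⟩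
  · simp only [AdmissibleSpeed, alph_one_pos_iff, Set.mem_Ioo, hne]
    grind
  · simp only [AdmissibleSpeed, alph_neg_one_pos_iff, Set.mem_Ioo, Set.mem_Ioi, Set.mem_Iio, hne']
    grind
  · simp only [AdmissibleSpeed, alph_neg_one_pos_iff, Set.mem_Ioo, Set.mem_Ioi, Set.mem_Iio, hne']
    grind

/-! ### The breather -/

/-- The second derivative of `N / D`, in the form in which adding `2 (N / D) (ln D)''` cancels the
last term and changes the sign of `N D''`. -/
theorem iteratedDeriv_two_div {N N₁ N₂ D D₁ D₂ : ℝ → ℂ} (hN : ∀ y, HasDerivAt N (N₁ y) y)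
    (hN₁ : ∀ y, HasDerivAt N₁ (N₂ y) y) (hD : ∀ y, HasDerivAt D (D₁ y) y)
    (hD₁ : ∀ y, HasDerivAt D₁ (D₂ y) y) (h0 : ∀ y, D y ≠ 0) (x : ℝ) :
    iteratedDeriv 2 (fun y => N y / D y) x =
      (N₂ x * D x - 2 * N₁ x * D₁ x - N x * D₂ x) / D x ^ 2 + 2 * N x * D₁ x ^ 2 / D x ^ 3 := by
  rw [iteratedDeriv_succ, iteratedDeriv_one]
  have h1 : deriv (fun y => N y / D y) = fun y => (N₁ y * D y - N y * D₁ y) / D y ^ 2 :=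
    funext fun y => ((hN y).div (hD y) (h0 y)).deriv
  have h2 := ((((hN₁ x).mul (hD x)).sub ((hN x).mul (hD₁ x))).div ((hD x).pow 2)
    (pow_ne_zero 2 (h0 x))).deriv
  rw [h1]
  refine h2.trans ?_
  have := h0 x
  simp only [Pi.mul_apply, Pi.sub_apply, Pi.pow_apply]
  field_simp
  push_cast
  ring

/-- The facts about the parameters of the breather that follow from admissibility and from the
equations for the phases. -/
structure BreatherData (σ k₁ c₁ c₂ φ ψ : ℝ) : Prop where
  sign : σ = 1 ∨ σ = -1
  wavenumber_pos : 0 < k₁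
  add_ne_zero : c₁ + k₁ ≠ 0
  sub_ne_zero : c₁ - k₁ ≠ 0
  sub_add_ne_zero : c₁ - k₁ + 2 * σ ≠ 0
  resonance : (c₁ - c₂) ^ 2 - k₁ ^ 2 ≠ 0
  alph_pos : 0 < alph σ c₂
  bet_pos : 0 < bet k₁ c₁ c₂
  gam_pos : 0 < gam k₁ c₁
  phase_pos : 0 < φ
  exp_phase : Real.exp ψ = (c₁ + k₁) / (c₁ - k₁) * Real.exp φ
  exp_phase_sq : Real.exp φ ^ 2 =
    ((c₁ - k₁) * (c₁ + k₁ + 2 * σ)) / ((c₁ + k₁) * (c₁ - k₁ + 2 * σ))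
  gam_sq : gam k₁ c₁ ^ 2 * Real.exp φ = Real.exp ψ

theorem AdmissibleWave.breatherData {σ k₁ c₁ c₂ φ ψ : ℝ} (h : AdmissibleWave σ k₁ c₁)
    (hp : IsPhase σ k₁ c₁ φ ψ) (hc : AdmissibleSpeed σ k₁ c₁ c₂) :
    BreatherData σ k₁ c₁ c₂ φ ψ := by
  obtain ⟨hα, hβ⟩ := (h.admissibleSpeed_iff c₂).1 hc
  obtain ⟨h1, h2⟩ := h.signs
  refine ⟨h.sign_cases, h.wavenumber_pos, left_ne_zero_of_mul h1.ne', right_ne_zero_of_mul h1.ne',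
    right_ne_zero_of_mul (right_ne_zero_of_mul h2.ne), ?_, hα, hβ, h.gam_pos, hp.1, hp.2.2, ?_, ?_⟩
  · intro h0
    rw [bet, h0, div_zero] at hβ
    exact hβ.false
  · rw [← hp.2.1, ← Real.exp_nat_mul]
    norm_num
  · rw [gam, Real.sq_sqrt h.ratio_pos.le, hp.2.2]

namespace BreatherData

variable {σ k₁ c₁ c₂ φ ψ : ℝ}

theorem exp_neg_phase_lt_one (hB : BreatherData σ k₁ c₁ c₂ φ ψ) : (Real.exp φ)⁻¹ < 1 := by
  rw [← Real.exp_neg, Real.exp_lt_one_iff]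
  linarith [hB.phase_pos]

theorem f_ne_zero (hB : BreatherData σ k₁ c₁ c₂ φ ψ) (x₁ x₂ : ℝ) {z : ℂ} (hz : 0 ≤ z.im) (t : ℝ) :
    f σ k₁ c₁ x₁ c₂ x₂ φ z t ≠ 0 := by
  have := profile_ne_zero c₁ x₁ c₂ x₂ hB.alph_pos.le (mul_pos hB.alph_pos hB.bet_pos).le
    hB.wavenumber_pos (inv_pos.2 (Real.exp_pos φ)) hB.exp_neg_phase_lt_one hz t
  rw [f_eq_profile]
  push_cast at this ⊢
  exact this

end BreatherData

/-- The `z`-derivative of `f`. -/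
noncomputable def fX (σ k₁ c₁ x₁ c₂ x₂ φ : ℝ) (z : ℂ) (t : ℝ) : ℂ :=
  profileX 1 (-(I * alph σ c₂)) (alph σ c₂ * bet k₁ c₁ c₂) (Real.exp φ : ℂ)⁻¹ k₁ c₁ x₁ c₂ x₂ z t

/-- The second `z`-derivative of `ln f`. -/
noncomputable def fLogXX (σ k₁ c₁ x₁ c₂ x₂ φ : ℝ) (z : ℂ) (t : ℝ) : ℂ :=
  profileLogXX 1 (-(I * alph σ c₂)) (alph σ c₂ * bet k₁ c₁ c₂) (Real.exp φ : ℂ)⁻¹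
    k₁ c₁ x₁ c₂ x₂ z t

/-- The `z`-derivative of `fTilde`. -/
noncomputable def fTildeX (σ k₁ c₁ x₁ c₂ x₂ φ : ℝ) (z : ℂ) (t : ℝ) : ℂ :=
  profileX (-1) (-(I * alph σ c₂)) (alph σ c₂ * bet k₁ c₁ c₂) (Real.exp φ : ℂ) k₁ c₁ x₁ c₂ x₂ z t

section

variable (σ k₁ c₁ x₁ c₂ x₂ φ ψ : ℝ) (z : ℂ) (t : ℝ)

theorem hasDerivAt_f : HasDerivAt (fun w => f σ k₁ c₁ x₁ c₂ x₂ φ w t)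
    (fX σ k₁ c₁ x₁ c₂ x₂ φ z t) z := by
  simp only [f_eq_profile]
  exact hasDerivAt_profile _ _ _ _ _ _ _ _ _ _ _

theorem hasDerivAt_fTilde : HasDerivAt (fun w => fTilde σ k₁ c₁ x₁ c₂ x₂ φ w t)
    (fTildeX σ k₁ c₁ x₁ c₂ x₂ φ z t) z := by
  simp only [fTilde_eq_profile]
  exact hasDerivAt_profile _ _ _ _ _ _ _ _ _ _ _

theorem fTilde_eq_conj : fTilde σ k₁ c₁ x₁ c₂ x₂ φ z t =
    -(Real.exp φ * wave k₁ c₁ x₁ 0 z t) * conj (f σ k₁ c₁ x₁ c₂ x₂ φ (conj z) t) := by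
  have := profile_eq_conj k₁ c₁ x₁ c₂ x₂ z t 1 (alph σ c₂) (alph σ c₂ * bet k₁ c₁ c₂)
    (Real.exp φ) (Real.exp_pos φ).ne'
  rw [fTilde_eq_profile, f_eq_profile]
  simpa only [ofReal_mul, ofReal_one] using this

theorem fTildeX_eq_conj : fTildeX σ k₁ c₁ x₁ c₂ x₂ φ z t =
    -(Real.exp φ * wave k₁ c₁ x₁ 0 z t) *
      (I * k₁ * conj (f σ k₁ c₁ x₁ c₂ x₂ φ (conj z) t) +
        conj (fX σ k₁ c₁ x₁ c₂ x₂ φ (conj z) t)) := by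
  have := profileX_eq_conj k₁ c₁ x₁ c₂ x₂ z t 1 (alph σ c₂) (alph σ c₂ * bet k₁ c₁ c₂)
    (Real.exp φ) (Real.exp_pos φ).ne'
  rw [fTildeX, fX, f_eq_profile]
  simpa only [ofReal_mul, ofReal_one] using this

end

namespace BreatherData

variable {σ k₁ c₁ c₂ φ ψ : ℝ}

theorem gTilde_eq_conj (hB : BreatherData σ k₁ c₁ c₂ φ ψ) (x₁ x₂ : ℝ) (z : ℂ) (t : ℝ) :
    gTilde σ k₁ c₁ x₁ c₂ x₂ ψ z t =
      -(Real.exp φ * wave k₁ c₁ x₁ 0 z t) * conj (g σ k₁ c₁ x₁ c₂ x₂ ψ (conj z) t) := by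
  have := profile_eq_conj k₁ c₁ x₁ c₂ x₂ z t (-(1 + σ * c₂)) (alph σ c₂)
    (alph σ c₂ * bet k₁ c₁ c₂) (Real.exp ψ) (Real.exp_pos ψ).ne'
  have hγ : (gam k₁ c₁ : ℂ) ≠ 0 := by exact_mod_cast hB.gam_pos.ne'
  simp only [ofReal_mul, ofReal_one, ofReal_neg, ofReal_add, neg_neg] at this
  rw [gTilde_eq_profile, g_eq_profile, this, ← hB.gam_sq, map_mul, conj_ofReal]
  push_cast
  field_simp

theorem fTilde_ne_zero (hB : BreatherData σ k₁ c₁ c₂ φ ψ) (x₁ x₂ : ℝ) {z : ℂ} (hz : z.im ≤ 0)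
    (t : ℝ) : fTilde σ k₁ c₁ x₁ c₂ x₂ φ z t ≠ 0 := by
  rw [fTilde_eq_conj]
  refine mul_ne_zero (neg_ne_zero.2 (mul_ne_zero ?_ (wave_ne_zero _ _ _ _ _ _)))
    ((map_ne_zero _).2 (hB.f_ne_zero x₁ x₂ (by simpa using hz) t))
  exact_mod_cast (Real.exp_pos φ).ne'

theorem conj_breather (hB : BreatherData σ k₁ c₁ c₂ φ ψ) (x₁ x₂ x t : ℝ) :
    conj (breather σ k₁ c₁ x₁ c₂ x₂ φ ψ x t) =
      gTilde σ k₁ c₁ x₁ c₂ x₂ ψ x t / fTilde σ k₁ c₁ x₁ c₂ x₂ φ x t := by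
  rw [hB.gTilde_eq_conj, fTilde_eq_conj, breather, map_div₀, conj_ofReal, mul_div_mul_left]
  refine neg_ne_zero.2 (mul_ne_zero ?_ (wave_ne_zero _ _ _ _ _ _))
  exact_mod_cast (Real.exp_pos φ).ne'

theorem norm_sq_breather (hB : BreatherData σ k₁ c₁ c₂ φ ψ) (x₁ x₂ x t : ℝ) :
    ((‖breather σ k₁ c₁ x₁ c₂ x₂ φ ψ x t‖ ^ 2 : ℝ) : ℂ) =
      1 - I * σ * (fX σ k₁ c₁ x₁ c₂ x₂ φ x t / f σ k₁ c₁ x₁ c₂ x₂ φ x t -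
        fTildeX σ k₁ c₁ x₁ c₂ x₂ φ x t / fTilde σ k₁ c₁ x₁ c₂ x₂ φ x t) := by
  have hf := hB.f_ne_zero x₁ x₂ (z := (x : ℂ)) (by simp) t
  have hf' := hB.fTilde_ne_zero x₁ x₂ (z := (x : ℂ)) (by simp) t
  have hγ : (gam k₁ c₁ : ℂ) ≠ 0 := by exact_mod_cast hB.gam_pos.ne'
  have key := bilinear_density (c₂ := c₂) hB.sign hB.add_ne_zero hB.sub_ne_zero hB.sub_add_ne_zero
    hB.resonance (Real.exp_pos φ).ne' hB.exp_phase hB.exp_phase_sq x₁ x₂ x t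
  simp only at key
  have hgg : g σ k₁ c₁ x₁ c₂ x₂ ψ x t * gTilde σ k₁ c₁ x₁ c₂ x₂ ψ x t =
      f σ k₁ c₁ x₁ c₂ x₂ φ x t * fTilde σ k₁ c₁ x₁ c₂ x₂ φ x t -
        I * σ * (fX σ k₁ c₁ x₁ c₂ x₂ φ x t * fTilde σ k₁ c₁ x₁ c₂ x₂ φ x t -
          f σ k₁ c₁ x₁ c₂ x₂ φ x t * fTildeX σ k₁ c₁ x₁ c₂ x₂ φ x t) := by
    rw [g_eq_profile, gTilde_eq_profile, fX, fTildeX, f_eq_profile, fTilde_eq_profile, ← key]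
    field_simp
  rw [ofReal_pow, ← mul_conj', hB.conj_breather, breather, div_mul_div_comm, hgg]
  field_simp

theorem norm_sq_breather_eq_logDeriv (hB : BreatherData σ k₁ c₁ c₂ φ ψ) (x₁ x₂ x t : ℝ) :
    ((‖breather σ k₁ c₁ x₁ c₂ x₂ φ ψ x t‖ ^ 2 : ℝ) : ℂ) =
      1 - I * σ * logDeriv (fun z : ℂ => f σ k₁ c₁ x₁ c₂ x₂ φ z t /
        fTilde σ k₁ c₁ x₁ c₂ x₂ φ z t) (x : ℂ) := by
  have h1 := hasDerivAt_f σ k₁ c₁ x₁ c₂ x₂ φ x t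
  have h2 := hasDerivAt_fTilde σ k₁ c₁ x₁ c₂ x₂ φ x t
  have h3 := logDeriv_div (x : ℂ) (hB.f_ne_zero x₁ x₂ (z := (x : ℂ)) (by simp) t)
    (hB.fTilde_ne_zero x₁ x₂ (z := (x : ℂ)) (by simp) t) h1.differentiableAt h2.differentiableAt
  rw [hB.norm_sq_breather, h3, logDeriv_apply, logDeriv_apply, h1.deriv, h2.deriv]

/-- On the real line `∂ₓ ln f̃ = i k₁ + conj (∂ₓ ln f)`, so the density is an affine function of
the imaginary part of `∂ₓ ln f`. -/
theorem norm_sq_breather_eq_im (hB : BreatherData σ k₁ c₁ c₂ φ ψ) (x₁ x₂ x t : ℝ) :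
    ‖breather σ k₁ c₁ x₁ c₂ x₂ φ ψ x t‖ ^ 2 =
      1 - σ * k₁ + 2 * σ *
        (fX σ k₁ c₁ x₁ c₂ x₂ φ x t / f σ k₁ c₁ x₁ c₂ x₂ φ x t).im := by
  have hf := hB.f_ne_zero x₁ x₂ (z := (x : ℂ)) (by simp) t
  have hf' := (map_ne_zero (starRingEnd ℂ)).2 hf
  have hE : -((Real.exp φ : ℂ) * wave k₁ c₁ x₁ 0 x t) ≠ 0 := by
    refine neg_ne_zero.2 (mul_ne_zero ?_ (wave_ne_zero _ _ _ _ _ _))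
    exact_mod_cast (Real.exp_pos φ).ne'
  have h1 : fTildeX σ k₁ c₁ x₁ c₂ x₂ φ x t / fTilde σ k₁ c₁ x₁ c₂ x₂ φ x t =
      I * k₁ + conj (fX σ k₁ c₁ x₁ c₂ x₂ φ x t / f σ k₁ c₁ x₁ c₂ x₂ φ x t) := by
    rw [fTildeX_eq_conj, fTilde_eq_conj, conj_ofReal, mul_div_mul_left _ _ hE, map_div₀]
    field_simp
  have h2 := hB.norm_sq_breather x₁ x₂ x t
  rw [h1, ← sub_sub, sub_right_comm, sub_conj] at h2
  have h3 := congrArg re h2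
  rw [ofReal_re] at h3
  rw [h3]
  simp
  ring

theorem densityDeriv_breather (hB : BreatherData σ k₁ c₁ c₂ φ ψ) (x₁ x₂ x t : ℝ) :
    densityDeriv (breather σ k₁ c₁ x₁ c₂ x₂ φ ψ) t x =
      2 * σ * ((fLogXX σ k₁ c₁ x₁ c₂ x₂ φ x t).im : ℂ) := by
  have hf := hB.f_ne_zero x₁ x₂ (z := (x : ℂ)) (by simp) t
  have h1 : HasDerivAt
      (fun y : ℝ => fX σ k₁ c₁ x₁ c₂ x₂ φ y t / f σ k₁ c₁ x₁ c₂ x₂ φ y t)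
      (fLogXX σ k₁ c₁ x₁ c₂ x₂ φ x t) x := by
    simp only [f_eq_profile] at hf ⊢
    exact (hasDerivAt_profileX_div hf).comp_ofReal
  have h2 := ((imCLM.hasFDerivAt.comp_hasDerivAt x h1).const_mul (2 * σ)).const_add (1 - σ * k₁)
  rw [densityDeriv]
  simp only [hB.norm_sq_breather_eq_im]
  refine (congrArg ofReal h2.deriv).trans ?_
  simp

theorem hasHilbertTransform_densityDeriv (hB : BreatherData σ k₁ c₁ c₂ φ ψ) (x₁ x₂ x t : ℝ) :
    HasHilbertTransform (densityDeriv (breather σ k₁ c₁ x₁ c₂ x₂ φ ψ) t) x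
      (2 * σ * ((fLogXX σ k₁ c₁ x₁ c₂ x₂ φ x t).re : ℂ)) := by
  have h := (hasHilbertTransform_profileLogXX c₁ x₁ c₂ x₂ hB.alph_pos
    (mul_pos hB.alph_pos hB.bet_pos).le hB.wavenumber_pos (inv_pos.2 (Real.exp_pos φ))
    hB.exp_neg_phase_lt_one t x).const_mul (2 * σ)
  rw [funext (hB.densityDeriv_breather x₁ x₂ · t)]
  simpa only [fLogXX, ofReal_mul, ofReal_inv] using h

theorem breather_equation (hB : BreatherData σ k₁ c₁ c₂ φ ψ) (x₁ x₂ x t : ℝ) :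
    I * deriv (fun s : ℝ => breather σ k₁ c₁ x₁ c₂ x₂ φ ψ x s) t =
      iteratedDeriv 2 (fun y : ℝ => breather σ k₁ c₁ x₁ c₂ x₂ φ ψ y t) x +
        2 * breather σ k₁ c₁ x₁ c₂ x₂ φ ψ x t * fLogXX σ k₁ c₁ x₁ c₂ x₂ φ x t := by
  have hf : ∀ y s : ℝ, profile 1 (-(I * alph σ c₂)) (alph σ c₂ * bet k₁ c₁ c₂)
      (Real.exp φ : ℂ)⁻¹ k₁ c₁ x₁ c₂ x₂ y s ≠ 0 := fun y s => by
    rw [← f_eq_profile]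
    exact hB.f_ne_zero x₁ x₂ (by simp) s
  have hmn : (Real.exp ψ : ℂ)⁻¹ * (c₁ + k₁) = (Real.exp φ : ℂ)⁻¹ * (c₁ - k₁) := by
    have h1 : (c₁ : ℂ) + k₁ ≠ 0 := by exact_mod_cast hB.add_ne_zero
    have h2 : (c₁ : ℂ) - k₁ ≠ 0 := by exact_mod_cast hB.sub_ne_zero
    have h3 : (Real.exp φ : ℂ) ≠ 0 := by exact_mod_cast (Real.exp_pos φ).ne'
    rw [hB.exp_phase, ofReal_mul]
    push_cast at h3 ⊢
    field_simp
  have key := bilinear_evolution (c₂ := c₂) hB.sign hB.add_ne_zero hB.resonance hmn x₁ x₂ x t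
  simp only at key
  simp only [breather, f_eq_profile, g_eq_profile, mul_div_assoc]
  have ht := ((hasDerivAt_profile_time (-(1 + σ * c₂)) (-(I * alph σ c₂))
      (alph σ c₂ * bet k₁ c₁ c₂) (Real.exp ψ : ℂ)⁻¹ k₁ c₁ x₁ c₂ x₂ x t).fun_div
    (hasDerivAt_profile_time 1 (-(I * alph σ c₂)) (alph σ c₂ * bet k₁ c₁ c₂)
      (Real.exp φ : ℂ)⁻¹ k₁ c₁ x₁ c₂ x₂ x t) (hf x t)).const_mul (gam k₁ c₁ : ℂ)
  rw [ht.deriv, iteratedDeriv_const_mul_field,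
    iteratedDeriv_two_div (fun y => (hasDerivAt_profile _ _ _ _ _ _ _ _ _ _ _).comp_ofReal)
      (fun y => (hasDerivAt_profileX _ _ _ _ _ _ _ _ _ _ _).comp_ofReal)
      (fun y => (hasDerivAt_profile _ _ _ _ _ _ _ _ _ _ _).comp_ofReal)
      (fun y => (hasDerivAt_profileX _ _ _ _ _ _ _ _ _ _ _).comp_ofReal) (fun y => hf y t),
    fLogXX, profileLogXX]
  have h0 := hf x t
  generalize (Real.exp φ : ℂ)⁻¹ = m at key h0 ⊢
  generalize (Real.exp ψ : ℂ)⁻¹ = n at key ⊢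
  generalize profile 1 (-(I * alph σ c₂)) (alph σ c₂ * bet k₁ c₁ c₂) m k₁ c₁ x₁ c₂ x₂ x t = F
    at key h0 ⊢
  field_simp
  linear_combination gam k₁ c₁ * F * key

theorem contDiff_breather (hB : BreatherData σ k₁ c₁ c₂ φ ψ) (x₁ x₂ : ℝ) :
    ContDiff ℝ 2 (fun p : ℝ × ℝ => breather σ k₁ c₁ x₁ c₂ x₂ φ ψ p.1 p.2) := by
  have hf : ∀ p : ℝ × ℝ, f σ k₁ c₁ x₁ c₂ x₂ φ (p.1 : ℂ) p.2 ≠ 0 := fun p =>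
    hB.f_ne_zero x₁ x₂ (by simp) p.2
  simp only [breather, f_eq_profile, g_eq_profile, div_eq_mul_inv] at hf ⊢
  exact (contDiff_const.mul (contDiff_profile _ _ _ _ _ _ _ _ _)).mul
    ((contDiff_profile _ _ _ _ _ _ _ _ _).inv hf)

theorem isClassicalSolution (hB : BreatherData σ k₁ c₁ c₂ φ ψ) (x₁ x₂ : ℝ) :
    IsClassicalSolution σ (breather σ k₁ c₁ x₁ c₂ x₂ φ ψ) := by
  refine ⟨hB.contDiff_breather x₁ x₂, fun x t =>
    ⟨_, hB.hasHilbertTransform_densityDeriv x₁ x₂ x t, ?_⟩⟩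
  rw [hB.breather_equation, hB.densityDeriv_breather]
  have hσ : (σ : ℂ) * σ = 1 := by
    rcases hB.sign with h | h <;> simp [h]
  have hre := re_add_im (fLogXX σ k₁ c₁ x₁ c₂ x₂ φ x t)
  linear_combination (-(2 * breather σ k₁ c₁ x₁ c₂ x₂ φ ψ x t)) * hre -
    2 * breather σ k₁ c₁ x₁ c₂ x₂ φ ψ x t *
      ((fLogXX σ k₁ c₁ x₁ c₂ x₂ φ x t).re + (fLogXX σ k₁ c₁ x₁ c₂ x₂ φ x t).im * I) * hσ

/-! ### Asymptotics -/

/-- The terms of `g` and `f` that grow with `ξ₂` cancel in the difference to the periodic wave. -/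
theorem breather_sub_periodicWave (hB : BreatherData σ k₁ c₁ c₂ φ ψ) (x₁ x₂ x t : ℝ) :
    let E := wave k₁ c₁ x₁ 0 x t
    let w := (Real.exp φ : ℂ)⁻¹ * E
    let v := (Real.exp ψ : ℂ)⁻¹ * E
    breather σ k₁ c₁ x₁ c₂ x₂ φ ψ x t - periodicWave k₁ c₁ x₁ φ ψ x t =
      gam k₁ c₁ * (-(2 + σ * c₂) * ((1 + v) * (1 + w)) +
        2 * (alph σ c₂ * bet k₁ c₁ c₂) * (w - v)) / (f σ k₁ c₁ x₁ c₂ x₂ φ x t * (1 + w)) := by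
  intro E w v
  have hγ : Real.exp ((ψ - φ) / 2) = gam k₁ c₁ := by
    refine (sq_eq_sq₀ (Real.exp_pos _).le hB.gam_pos.le).1 ?_
    rw [← Real.exp_nat_mul, Nat.cast_ofNat, mul_div_cancel₀ _ (two_ne_zero' ℝ), Real.exp_sub,
      ← hB.gam_sq, mul_div_cancel_right₀ _ (Real.exp_pos φ).ne']
  have hm : 0 < (Real.exp φ)⁻¹ := inv_pos.2 (Real.exp_pos φ)
  have hw : ‖w‖ < 1 := by
    have := norm_mul_wave_le hB.wavenumber_pos hm c₁ x₁ (z := (x : ℂ)) (by simp) t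
    rw [ofReal_inv] at this
    exact this.trans_lt hB.exp_neg_phase_lt_one
  have hw1 := one_add_ne_zero_of_norm_lt_one hw
  have hf := hB.f_ne_zero x₁ x₂ (z := (x : ℂ)) (by simp) t
  have hg' : g σ k₁ c₁ x₁ c₂ x₂ ψ x t = gam k₁ c₁ *
      ((-(1 + σ * c₂) + -(I * alph σ c₂) * xi c₂ x₂ x t) * (1 + v) +
        alph σ c₂ * bet k₁ c₁ c₂ * (1 - v)) := g_eq_profile _ _ _ _ _ _ _ _ _
  have hf' : f σ k₁ c₁ x₁ c₂ x₂ φ x t =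
      (1 + -(I * alph σ c₂) * xi c₂ x₂ x t) * (1 + w) + alph σ c₂ * bet k₁ c₁ c₂ * (1 - w) :=
    f_eq_profile _ _ _ _ _ _ _ _ _
  have hper : periodicWave k₁ c₁ x₁ φ ψ x t = gam k₁ c₁ * ((1 + v) / (1 + w)) := by
    rw [periodicWave, hγ, wave_eq_exp_mul k₁ c₁ x₁ (-ψ), wave_eq_exp_mul k₁ c₁ x₁ (-φ),
      Real.exp_neg, Real.exp_neg, ofReal_inv, ofReal_inv]
  rw [breather, hper, eq_div_iff (mul_ne_zero hf hw1)]
  clear_value w v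
  field_simp
  rw [hg', hf']
  ring

theorem tendsto_breather_sub (hB : BreatherData σ k₁ c₁ c₂ φ ψ) (x₁ x₂ : ℝ) :
    Tendsto (fun p : ℝ × ℝ => breather σ k₁ c₁ x₁ c₂ x₂ φ ψ p.1 p.2 -
        periodicWave k₁ c₁ x₁ φ ψ p.1 p.2)
      (comap (fun p : ℝ × ℝ => |p.1 - c₂ * p.2 - x₂|) atTop) (𝓝 0) := by
  have hα := hB.alph_pos
  have hr := mul_pos hB.alph_pos hB.bet_pos
  have hm : 0 < (Real.exp φ)⁻¹ := inv_pos.2 (Real.exp_pos φ)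
  have hm1 := hB.exp_neg_phase_lt_one
  set α := alph σ c₂
  set r := α * bet k₁ c₁ c₂
  set m := (Real.exp φ)⁻¹ with hmdef
  set n := (Real.exp ψ)⁻¹ with hndef
  have hn : 0 < n := inv_pos.2 (Real.exp_pos ψ)
  set K := gam k₁ c₁ * (|2 + σ * c₂| * ((1 + n) * (1 + m)) + 2 * r * (m + n))
  have h1m : 0 < 1 - m := by linarith
  have hbound : ∀ p : ℝ × ℝ, 0 < α * |p.1 - c₂ * p.2 - x₂| * (1 - m) - r * (1 + m) →
      ‖breather σ k₁ c₁ x₁ c₂ x₂ φ ψ p.1 p.2 - periodicWave k₁ c₁ x₁ φ ψ p.1 p.2‖ ≤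
        K / ((α * |p.1 - c₂ * p.2 - x₂| * (1 - m) - r * (1 + m)) * (1 - m)) := by
    rintro ⟨x, t⟩ hp
    simp only at hp ⊢
    rw [hB.breather_sub_periodicWave]
    set w := (Real.exp φ : ℂ)⁻¹ * wave k₁ c₁ x₁ 0 x t with hwdef
    set v := (Real.exp ψ : ℂ)⁻¹ * wave k₁ c₁ x₁ 0 x t
    have hw : ‖w‖ ≤ m := by
      have := norm_mul_wave_le hB.wavenumber_pos hm c₁ x₁ (z := (x : ℂ)) (by simp) t
      rwa [ofReal_inv] at this
    have hv : ‖v‖ ≤ n := by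
      have := norm_mul_wave_le hB.wavenumber_pos hn c₁ x₁ (z := (x : ℂ)) (by simp) t
      rwa [ofReal_inv] at this
    have a1 : ‖1 + v‖ ≤ 1 + n := (norm_add_le _ _).trans (by simpa using hv)
    have a2 : ‖1 + w‖ ≤ 1 + m := (norm_add_le _ _).trans (by simpa using hw)
    have a3 : ‖1 - w‖ ≤ 1 + m := (norm_sub_le _ _).trans (by simpa using hw)
    have a4 : ‖w - v‖ ≤ m + n := (norm_sub_le _ _).trans (add_le_add hw hv)
    have a5 : 1 - m ≤ ‖1 + w‖ := one_sub_le_norm_one_add hw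
    have hnum : ‖(gam k₁ c₁ : ℂ) * (-(2 + σ * c₂) * ((1 + v) * (1 + w)) +
        2 * (α * bet k₁ c₁ c₂) * (w - v))‖ ≤ K := by
      rw [norm_mul, norm_real, Real.norm_of_nonneg hB.gam_pos.le]
      refine mul_le_mul_of_nonneg_left ((norm_add_le _ _).trans (add_le_add ?_ ?_)) hB.gam_pos.le
      · have : (-(2 + σ * c₂) : ℂ) = ((-(2 + σ * c₂) : ℝ) : ℂ) := by push_cast; ring
        rw [norm_mul, norm_mul, this, norm_real, Real.norm_eq_abs, abs_neg]
        gcongr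
      · have : (2 * (α * bet k₁ c₁ c₂) : ℂ) = ((2 * r : ℝ) : ℂ) := by
          simp only [r]; push_cast; ring
        rw [norm_mul, this, norm_real, Real.norm_of_nonneg (by positivity)]
        gcongr
    have hden : α * |x - c₂ * t - x₂| * (1 - m) - r * (1 + m) ≤
        ‖f σ k₁ c₁ x₁ c₂ x₂ φ x t‖ := by
      have b1 : α * |x - c₂ * t - x₂| ≤ ‖(1 : ℂ) + -(I * α) * xi c₂ x₂ x t‖ := by
        refine le_trans (le_of_eq ?_) (abs_im_le_norm _)
        rw [← abs_of_pos hα, ← abs_mul, abs_of_pos hα, ← abs_neg]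
        congr 1
        simp [xi]
      rw [f_eq_profile, profile, ← hwdef]
      have b2 := norm_sub_le_norm_add ((1 + -(I * α) * xi c₂ x₂ x t) * (1 + w))
        ((α : ℂ) * bet k₁ c₁ c₂ * (1 - w))
      have b3 : ‖(α : ℂ) * bet k₁ c₁ c₂ * (1 - w)‖ ≤ r * (1 + m) := by
        rw [norm_mul, ← ofReal_mul, norm_real, Real.norm_of_nonneg hr.le]
        gcongr
      have b4 : α * |x - c₂ * t - x₂| * (1 - m) ≤
          ‖(1 + -(I * α) * xi c₂ x₂ x t) * (1 + w)‖ := by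
        rw [norm_mul]
        gcongr
      linarith
    rw [norm_div, norm_mul (f σ k₁ c₁ x₁ c₂ x₂ φ x t)]
    exact div_le_div₀ ((norm_nonneg _).trans hnum) hnum (mul_pos hp h1m)
      (mul_le_mul hden a5 h1m.le (norm_nonneg _))
  have hξ : Tendsto (fun p : ℝ × ℝ => |p.1 - c₂ * p.2 - x₂|)
      (comap (fun p : ℝ × ℝ => |p.1 - c₂ * p.2 - x₂|) atTop) atTop := tendsto_comap
  have hD := tendsto_atTop_add_const_right _ (-(r * (1 + m)))
    ((hξ.const_mul_atTop hα).atTop_mul_const h1m)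
  simp only [← sub_eq_add_neg] at hD
  refine squeeze_zero_norm' ?_ ((hD.atTop_mul_const h1m).const_div_atTop K)
  filter_upwards [hD.eventually_gt_atTop 0] with p hp using hbound p hp

theorem exists_breather_ne (hB : BreatherData σ k₁ c₁ c₂ φ ψ) (x₁ x₂ t : ℝ) :
    ∃ x : ℝ, breather σ k₁ c₁ x₁ c₂ x₂ φ ψ x t ≠ periodicWave k₁ c₁ x₁ φ ψ x t := by
  by_contra! hall
  set m := (Real.exp φ)⁻¹
  set n := (Real.exp ψ)⁻¹
  have hm : 0 < m := inv_pos.2 (Real.exp_pos φ)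
  have hn : 0 < n := inv_pos.2 (Real.exp_pos ψ)
  have hγ : (gam k₁ c₁ : ℂ) ≠ 0 := by exact_mod_cast hB.gam_pos.ne'
  have hzero : ∀ (x : ℝ) (e : ℝ), wave k₁ c₁ x₁ 0 x t = e → |e| = 1 →
      -(2 + σ * c₂) * ((1 + n * e) * (1 + m * e)) +
        2 * (alph σ c₂ * bet k₁ c₁ c₂) * (m * e - n * e) = 0 := by
    intro x e he habs
    have h := hB.breather_sub_periodicWave x₁ x₂ x t
    simp only [hall x, sub_self, he] at h
    have hf := hB.f_ne_zero x₁ x₂ (z := (x : ℂ)) (by simp) t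
    have hw1 : 1 + (Real.exp φ : ℂ)⁻¹ * e ≠ 0 := by
      refine one_add_ne_zero_of_norm_lt_one ?_
      rw [norm_mul, norm_inv, norm_real, norm_real, Real.norm_eq_abs e, habs, mul_one,
        Real.norm_of_nonneg (Real.exp_pos φ).le]
      exact hB.exp_neg_phase_lt_one
    rw [eq_comm, div_eq_zero_iff, or_iff_left (mul_ne_zero hf hw1), mul_eq_zero,
      or_iff_right hγ] at h
    exact_mod_cast h
  -- The two points where `e^{i k₁ ξ₁}` equals `1` and `-1`.
  have hk : (k₁ : ℂ) ≠ 0 := by exact_mod_cast hB.wavenumber_pos.ne'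
  have h1 := hzero (c₁ * t + x₁) 1 (by simp [wave, xi]) (by simp)
  have h2 := hzero (c₁ * t + x₁ + Real.pi / k₁) (-1) (by
    rw [wave, xi]
    push_cast
    rw [← exp_pi_mul_I]
    congr 1
    field_simp
    ring) (by simp)
  have h3 : (2 + σ * c₂) * (1 + n * m) = 0 := by linear_combination (-1 / 2) * (h1 + h2)
  have h4 : 2 + σ * c₂ = 0 := (mul_eq_zero.1 h3).resolve_right (by positivity)
  have hα := hB.alph_pos
  have h5 : alph σ c₂ = 0 := by
    rw [alph]
    rcases hB.sign with rfl | rfl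
    · linear_combination (-(1 / 2) * c₂) * h4
    · linear_combination (-(1 / 2) * c₂) * h4
  linarith

end BreatherData

end NDNLS

theorem mainTheorem3 (σ k₁ c₁ : ℝ) (hadm : NDNLS.AdmissibleWave σ k₁ c₁) :
    (∃! p : ℝ × ℝ, NDNLS.IsPhase σ k₁ c₁ p.1 p.2) ∧
    0 < (c₁ + k₁) / (c₁ - k₁) ∧ 0 < NDNLS.gam k₁ c₁ ∧
    (∀ c₂ : ℝ, NDNLS.AdmissibleSpeed σ k₁ c₁ c₂ ↔
      (0 < NDNLS.alph σ c₂ ∧ 0 < NDNLS.bet k₁ c₁ c₂)) ∧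
    (∀ φ ψ : ℝ, NDNLS.IsPhase σ k₁ c₁ φ ψ →
      ∀ c₂ : ℝ, NDNLS.AdmissibleSpeed σ k₁ c₁ c₂ →
      ∀ x₁ x₂ : ℝ,
        (∀ (z : ℂ) (t : ℝ), NDNLS.f σ k₁ c₁ x₁ c₂ x₂ φ z t = 0 → z.im < 0) ∧
        (∀ (z : ℂ) (t : ℝ), NDNLS.fTilde σ k₁ c₁ x₁ c₂ x₂ φ z t = 0 → 0 < z.im) ∧
        (∀ x t : ℝ,
          (starRingEnd ℂ) (NDNLS.breather σ k₁ c₁ x₁ c₂ x₂ φ ψ x t) =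
            NDNLS.gTilde σ k₁ c₁ x₁ c₂ x₂ ψ x t / NDNLS.fTilde σ k₁ c₁ x₁ c₂ x₂ φ x t) ∧
        (∀ x t : ℝ,
          ((‖NDNLS.breather σ k₁ c₁ x₁ c₂ x₂ φ ψ x t‖ ^ 2 : ℝ) : ℂ) =
            1 - Complex.I * (σ : ℂ) *
              logDeriv (fun z : ℂ => NDNLS.f σ k₁ c₁ x₁ c₂ x₂ φ z t /
                NDNLS.fTilde σ k₁ c₁ x₁ c₂ x₂ φ z t) (x : ℂ)) ∧
        NDNLS.IsClassicalSolution σ (NDNLS.breather σ k₁ c₁ x₁ c₂ x₂ φ ψ) ∧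
        NDNLS.IsSolitaryWaveOn c₂ x₂ (NDNLS.breather σ k₁ c₁ x₁ c₂ x₂ φ ψ)
          (NDNLS.periodicWave k₁ c₁ x₁ φ ψ)) := by
  refine ⟨hadm.existsUnique_phase, hadm.ratio_pos, hadm.gam_pos, hadm.admissibleSpeed_iff,
    fun φ ψ hp c₂ hc x₁ x₂ => ?_⟩
  have hB := hadm.breatherData hp hc
  refine ⟨fun z t h => ?_, fun z t h => ?_, hB.conj_breather x₁ x₂,
    hB.norm_sq_breather_eq_logDeriv x₁ x₂, hB.isClassicalSolution x₁ x₂,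
    hB.tendsto_breather_sub x₁ x₂, hB.exists_breather_ne x₁ x₂⟩
  · by_contra! hz
    exact hB.f_ne_zero x₁ x₂ hz t h
  · by_contra! hz
    exact hB.fTilde_ne_zero x₁ x₂ hz t h
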